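/- Let $p\ge 2$ and $q\ge p$ be integers, and let $M=\mathbb S^1\times\mathbb S^{p+q-1}$ with its standard real-analytic structure. There are a nonempty open set $\Lambda\subset\mathbb R^2$ and a family $(g_\lambda)_{\lambda\in\Lambda}$ of real-analytic pseudo-Riemannian metrics of type $(p,q)$ on $M$ ($p$ minus signs and $q$ plus signs), depending real-analytically on $(\lambda,x)\in\Lambda\times M$, such that the conformal classes $[g_\lambda]=\{c\,g_\lambda : c\in C^\infty(M),\ c>0\}$ have the following properties. (1) For every $\lambda\in\Lambda$, $(M,[g_\lambda])$ is not conformally flat, i.e. it is not true that every point of $M$ has an open neighbourhood admitting a smooth conformal local diffeomorphism into the flat space $\mathbb R^{p,q}$. (2) For every $\lambda\in\Lambda$, the group $\mathrm{Conf}(M,[g_\lambda])$ of smooth diffeomorphisms $f$ of $M$ with $f^*g_\lambda\in[g_\lambda]$ is essential: there is no metric $h\in[g_\lambda]$ such that $f^*h=h$ for all $f\in\mathrm{Conf}(M,[g_\lambda])$. (3) For every $\lambda\in\Lambda$, this group is even strongly essential: there is no finite Borel measure on $M$ that is nonzero on every nonempty open set and is preserved by all $f\in\mathrm{Conf}(M,[g_\lambda])$.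 (4) For distinct $\lambda,\mu\in\Lambda$, $(M,[g_\lambda])$ and $(M,[g_\mu])$ are not conformally equivalent: there is no smooth diffeomorphism $f$ of $M$ with $f^*g_\mu\in[g_\lambda]$. Since $M$ is compact of dimension $p+q\ge 4$, this gives a negative answer to the question whether a compact pseudo-Riemannian manifold of dimension at least $3$ with essential conformal group must be conformally flat. -/

import Mathlib

open Set Bundle MeasureTheory
open scoped Manifold ContDiff Topology

noncomputable section

namespace PseudoConformal

/-- The standard symmetric bilinear form of type `(p, q)` (`p` minus signs, `q` plus signs)
on `ℝ^(p+q)`. -/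
def stdForm (p q : ℕ) (u v : Fin p ⊕ Fin q → ℝ) : ℝ :=
  -(∑ i : Fin p, u (Sum.inl i) * v (Sum.inl i)) + ∑ j : Fin q, u (Sum.inr j) * v (Sum.inr j)

section

variable {E : Type*} [NormedAddCommGroup E] [NormedSpace ℝ E]
  {H : Type*} [TopologicalSpace H] (I : ModelWithCorners ℝ E H)
  (M : Type*) [TopologicalSpace M] [ChartedSpace H M]

/-- A (not necessarily continuous) field of bilinear forms on the tangent spaces of `M`. -/
abbrev BilinField : Type _ :=
  ∀ x : M, TangentSpace I x →L[ℝ] TangentSpace I x →L[ℝ] ℝ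

variable {M}
variable [IsManifold I 1 M]

/-- `g` is a pseudo-Riemannian metric of type `(p, q)` and of class `C^n`: a `C^n` section of the
bundle of bilinear forms on the tangent bundle, such that every tangent space with `g x` is
isometric to `ℝ^(p+q)` with its standard form of type `(p, q)`.
(This includes symmetry and nondegeneracy.  `n = ω` means real-analytic.) -/
structure IsPseudoRiemannianMetric (n : WithTop ℕ∞) (p q : ℕ) (g : BilinField I M) : Prop where
  contMDiff : ContMDiff I (I.prod 𝓘(ℝ, E →L[ℝ] E →L[ℝ] ℝ)) n
    (fun x : M => (TotalSpace.mk' (E →L[ℝ] E →L[ℝ] ℝ) x (g x) :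
      TotalSpace (E →L[ℝ] E →L[ℝ] ℝ)
        (fun x : M => TangentSpace I x →L[ℝ] TangentSpace I x →L[ℝ] ℝ)))
  type : ∀ x : M, ∃ L : TangentSpace I x ≃ₗ[ℝ] (Fin p ⊕ Fin q → ℝ),
    ∀ u v : TangentSpace I x, g x u v = stdForm p q (L u) (L v)

/-- A family `g` of fields of bilinear forms on `M` depends real-analytically on the parameter
in `Λ ⊆ ℝ²` and on the point of `M` jointly. -/
def IsAnalyticFamilyOn (Λ : Set (ℝ × ℝ)) (g : ℝ × ℝ → BilinField I M) : Prop :=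
  ContMDiffOn (𝓘(ℝ, ℝ × ℝ).prod I) (I.prod 𝓘(ℝ, E →L[ℝ] E →L[ℝ] ℝ)) ω
    (fun y : (ℝ × ℝ) × M => (TotalSpace.mk' (E →L[ℝ] E →L[ℝ] ℝ) y.2 (g y.1 y.2) :
      TotalSpace (E →L[ℝ] E →L[ℝ] ℝ)
        (fun x : M => TangentSpace I x →L[ℝ] TangentSpace I x →L[ℝ] ℝ)))
    (Λ ×ˢ univ)

end

section

variable {E : Type*} [NormedAddCommGroup E] [NormedSpace ℝ E]
  {H : Type*} [TopologicalSpace H] (I : ModelWithCorners ℝ E H)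
  {M : Type*} [TopologicalSpace M] [ChartedSpace H M]
  {N : Type*} [TopologicalSpace N] [ChartedSpace H N]

/-- The conformal class `[g]`: all `c • g` with `c` a smooth positive function on `M`. -/
def conformalClass (g : BilinField I M) : Set (BilinField I M) :=
  {h | ∃ c : M → ℝ, ContMDiff I 𝓘(ℝ, ℝ) ∞ c ∧ (∀ x, 0 < c x) ∧ ∀ x, h x = c x • g x}

/-- The pullback `f^* h`, that is `(f^* h)_x (u, v) = h_{f x} (df_x u, df_x v)`. -/
def pullback (f : M → N) (h : BilinField I N) : BilinField I M :=
  fun x => (ContinuousLinearMap.precomp ℝ (mfderiv I I f x)).comp ((h (f x)).comp (mfderiv I I f x))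

theorem pullback_apply (f : M → N) (h : BilinField I N) (x : M) (u v : TangentSpace I x) :
    pullback I f h x u v = h (f x) (mfderiv I I f x u) (mfderiv I I f x v) :=
  rfl

/-- `(M, [g])` and `(N, [h])` are conformally equivalent: there is a smooth diffeomorphism
`f : M → N` with `f^* h ∈ [g]`. -/
def ConformallyEquivalent (g : BilinField I M) (h : BilinField I N) : Prop :=
  ∃ f : M ≃ₘ^∞⟮I, I⟯ N, pullback I f h ∈ conformalClass I g

/-- (The underlying set of) the conformal group of `(M, [g])`: all smooth diffeomorphisms `f` of
`M` with `f^* g ∈ [g]`. -/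
def conformalGroup (g : BilinField I M) : Set (M ≃ₘ^∞⟮I, I⟯ M) :=
  {f | pullback I f g ∈ conformalClass I g}

/-- The conformal group of `(M, [g])` is essential: it does not act isometrically for any metric
of the conformal class. -/
def IsEssential (g : BilinField I M) : Prop :=
  ¬ ∃ h ∈ conformalClass I g, ∀ f ∈ conformalGroup I g, pullback I f h = h

/-- The conformal group of `(M, [g])` is strongly essential: it does not preserve any finite
measure on the Borel sets of `M` which is nonzero on nonempty open subsets. -/
def IsStronglyEssential (g : BilinField I M) : Prop :=
  ∀ (_ : MeasurableSpace M) (_ : BorelSpace M) (μ : Measure M),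
    IsFiniteMeasure μ → μ.IsOpenPosMeasure →
      ¬ ∀ f ∈ conformalGroup I g, μ.map f = μ

/-- `(M, [g])` is conformally flat (as a structure of type `(p, q)`): every point has an open
neighbourhood `U` with a smooth map `f` from `U` to the flat space `ℝ^(p+q)` of type `(p, q)`
such that the pullback of the flat metric is a smooth positive multiple of `g` on `U`.
If `g` has type `(p, q)`, then `f` is automatically a local diffeomorphism on `U`. -/
def IsConformallyFlat (p q : ℕ) (g : BilinField I M) : Prop :=
  ∀ x : M, ∃ U : Set M, IsOpen U ∧ x ∈ U ∧
    ∃ (f : M → (Fin p ⊕ Fin q → ℝ)) (c : M → ℝ),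
      ContMDiffOn I 𝓘(ℝ, Fin p ⊕ Fin q → ℝ) ∞ f U ∧
      ContMDiffOn I 𝓘(ℝ, ℝ) ∞ c U ∧
      ∀ y ∈ U, 0 < c y ∧ ∀ u v : TangentSpace I y,
        stdForm p q (mfderiv I 𝓘(ℝ, Fin p ⊕ Fin q → ℝ) f y u)
          (mfderiv I 𝓘(ℝ, Fin p ⊕ Fin q → ℝ) f y v) = c y * g y u v

end

end PseudoConformal

end

/-!
The metrics come from one plane wave. On `ℝ^(n+1)`, with coordinates `x₀, …, x₃` and further
coordinates `y`, `z`, the metric `2 dx₀ dx₂ + 2 dx₁ dx₃ - ∑ dy² + ∑ dz² + x₃² dx₂²` (`metric e 1`)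
is multiplied by `exp (2 (a + b))` under the diagonal homothety `dil e (a, b)` with the exponents
`a + 2b`, `2a + b`, `a`, `b` and `a + b`. For `l = (a, b)` with `a, b > 0` the flow
`t ↦ dil e (t • l)` expands, each of its nontrivial orbits meets the unit sphere once, and the
quotient of `ℝ^(n+1) ∖ 0` by `dil e ((2 * π) • l)` is `𝕊¹ × 𝕊ⁿ`. The metric `field e l` is a
representative of the induced conformal class that is analytic in `l`, and `proj e l` is the
quotient map.

* The curvature `R (u, v, u, v)` on isotropic planes is conformally covariant
  (`curvature_at_origin`). For the plane wave it is a nonzero multiple of `(dx₃ ∧ dx₂)²`, so the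
  plane wave is not conformally flat (`not_conformal_to_flat`), and its local conformal maps
  preserve the distribution `dx₂ = dx₃ = 0` (`kernel_of_conformal_map`).
* All homotheties `dil e b` commute with the deck transformation and give conformal maps
  `flow e l b` of `𝕊¹ × 𝕊ⁿ`. For `b = (2, -1)` the exponent on the `x₀`-axis is zero: the points of
  this axis are fixed, but the metric is multiplied by `exp 2` there (`isEssential_field`). The
  same map has a wandering open set (`isStronglyEssential_field`).
* A conformal equivalence between the quotients for `l` and `m` lifts to a conformal map `F` on the
  half-space `x₀ > 0`, which satisfies `F ∘ dil e ((2 * π) • l) = dil e ((2 * π * k) • m) ∘ F` for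
  an integer `k` (`exists_int_mul_of_conformallyEquivalent`). By the invariance of `dx₂ = dx₃ = 0`,
  the coordinates `x₂` and `x₃` of `F` depend on `x₂` and `x₃` only, and the derivative in these
  coordinates shows that each component of `k • m` is a component of `l`
  (`weights_of_intertwining`). For `l` and `m` in `parameters` this forces `k = 1` and `l = m`.
-/

noncomputable section

set_option linter.unusedSectionVars false

namespace PlaneWave

/-! ### The linear algebra of the isotropic plane -/

section

variable {ι : Type*} [Fintype ι] {r s : ℕ} (e : Fin 4 ⊕ (Fin r ⊕ Fin s) ≃ ι)

/-- The coordinate `x_k` on `ℝ^ι`, for `k = 0, 1, 2, 3`. The indices in `ι` are labelled by `e`: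
four distinguished ones, `r` negative ones and `s` positive ones. -/
def coord (k : Fin 4) : EuclideanSpace ℝ ι →L[ℝ] ℝ := EuclideanSpace.proj (e (.inl k))

/-- The sign of an index: `0` on the four distinguished indices, `-1` on the next `r` and `1` on the
last `s`. -/
def sgn (i : ι) : ℝ := Sum.elim (fun _ => 0) (Sum.elim (fun _ => -1) fun _ => 1) (e.symm i)

/-- The bilinear form `2 dx₀ dx₂ + 2 dx₁ dx₃ - ∑ dy_i² + ∑ dz_j²` of type `(r + 2, s + 2)`, with the
four distinguished coordinates grouped into two hyperbolic planes. -/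
def form : EuclideanSpace ℝ ι →L[ℝ] EuclideanSpace ℝ ι →L[ℝ] ℝ :=
  (coord e 0).smulRight (coord e 2) + (coord e 2).smulRight (coord e 0) +
    (coord e 1).smulRight (coord e 3) + (coord e 3).smulRight (coord e 1) +
    ∑ i, sgn e i • (EuclideanSpace.proj i : EuclideanSpace ℝ ι →L[ℝ] ℝ).smulRight
      (EuclideanSpace.proj i : EuclideanSpace ℝ ι →L[ℝ] ℝ)

theorem form_apply (u v : EuclideanSpace ℝ ι) :
    form e u v = coord e 0 u * coord e 2 v + coord e 2 u * coord e 0 v +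
      coord e 1 u * coord e 3 v + coord e 3 u * coord e 1 v + ∑ i, sgn e i * (u i * v i) := by
  simp [form]

theorem form_comm (u v : EuclideanSpace ℝ ι) : form e u v = form e v u := by
  simp only [form_apply, mul_comm (u _) (v _)]
  ring

theorem coord_apply (k : Fin 4) (u : EuclideanSpace ℝ ι) : coord e k u = u (e (.inl k)) := rfl

@[simp] theorem sgn_inl (k : Fin 4) : sgn e (e (.inl k)) = 0 := by simp [sgn]

theorem sgn_inr_sq (j : Fin r ⊕ Fin s) : sgn e (e (.inr j)) ^ 2 = 1 := by
  rcases j with j | j <;> simp [sgn]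

variable [DecidableEq ι]

/-- The basis vector dual to the coordinate `coord e k`. -/
def vec (k : Fin 4) : EuclideanSpace ℝ ι := EuclideanSpace.single (e (.inl k)) 1

theorem coord_vec (j k : Fin 4) : coord e j (vec e k) = if j = k then 1 else 0 := by
  simp [coord_apply, vec]

theorem form_single (u : EuclideanSpace ℝ ι) (j : Fin r ⊕ Fin s) :
    form e u (EuclideanSpace.single (e (.inr j)) 1) = sgn e (e (.inr j)) * u (e (.inr j)) := by
  simp [form_apply, coord_apply]

theorem form_vec (u : EuclideanSpace ℝ ι) (k : Fin 4) :
    form e u (vec e k) = coord e (k + 2) u := by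
  have : ∑ i, sgn e i * (u i * (vec e k) i) = 0 := by
    simp [vec]
  rw [form_apply, this]
  fin_cases k <;> simp [coord_vec]

theorem eq_zero_of_form {u : EuclideanSpace ℝ ι} (h : ∀ v, form e u v = 0) : u = 0 := by
  ext i
  obtain ⟨j, rfl⟩ := e.surjective i
  rcases j with k | j
  · have := h (vec e (k + 2))
    rw [form_vec, show k + 2 + 2 = k by fin_cases k <;> rfl] at this
    exact this
  · have := h (EuclideanSpace.single (e (.inr j)) 1)
    rw [form_single] at this
    have h2 := sgn_inr_sq e j
    rcases mul_eq_zero.1 this with h | h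
    · simp [h] at h2
    · exact h

theorem injective_of_conformal {c : ℝ} (hc : c ≠ 0) {L : EuclideanSpace ℝ ι →L[ℝ] EuclideanSpace ℝ ι}
    (hL : ∀ u v, form e (L u) (L v) = c * form e u v) : Function.Injective L := by
  rw [injective_iff_map_eq_zero]
  intro u hu
  refine eq_zero_of_form e fun v => ?_
  have := hL u v
  simp only [hu, map_zero, zero_apply] at this
  simpa [hc] using this.symm

theorem surjective_of_conformal {c : ℝ} (hc : c ≠ 0) {L : EuclideanSpace ℝ ι →L[ℝ] EuclideanSpace ℝ ι}
    (hL : ∀ u v, form e (L u) (L v) = c * form e u v) : Function.Surjective L :=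
  (LinearMap.injective_iff_surjective (f := L.toLinearMap)).1 (injective_of_conformal e hc hL)

/-- The projection to the non-distinguished coordinates, followed by the change of the negative
ones to their opposites, so that `form e (signFlip e a) a` is a sum of squares. -/
def signFlip (a : EuclideanSpace ℝ ι) : EuclideanSpace ℝ ι := WithLp.toLp 2 fun i => sgn e i * a i

theorem sgn_cube (i : ι) : sgn e i ^ 3 = sgn e i := by
  obtain ⟨j, rfl⟩ := e.surjective i
  rcases j with k | j
  · simp
  · rw [pow_succ, sgn_inr_sq, one_mul]

/-- If the 2-form `dx₃ ∧ dx₂` vanishes on `y ∧ z` for all isotropic `z` orthogonal to `y`, then `y`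
is in the kernel of `dx₂` and `dx₃`. -/
theorem eq_zero_of_isotropic_plane {y : EuclideanSpace ℝ ι}
    (h : ∀ z, form e z z = 0 → form e y z = 0 → coord e 3 y * coord e 2 z = coord e 2 y * coord e 3 z) :
    coord e 2 y = 0 ∧ coord e 3 y = 0 := by
  by_contra hne
  set a := coord e 2 y with ha
  set b := coord e 3 y with hb
  have hab : a ^ 2 + b ^ 2 ≠ 0 := by
    intro h0
    exact hne ⟨by nlinarith [sq_nonneg a, sq_nonneg b], by nlinarith [sq_nonneg a, sq_nonneg b]⟩
  -- an isotropic vector orthogonal to `y` that violates the hypothesis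
  let t : ℝ := (coord e 1 y * a - coord e 0 y * b) / (a ^ 2 + b ^ 2)
  let z : EuclideanSpace ℝ ι := (t * a) • vec e 0 + (t * b) • vec e 1 + b • vec e 2 - a • vec e 3
  have h0 : coord e 0 z = t * a := by simp [z, coord_vec]
  have h1 : coord e 1 z = t * b := by simp [z, coord_vec]
  have h2 : coord e 2 z = b := by simp [z, coord_vec]
  have h3 : coord e 3 z = - a := by simp [z, coord_vec]
  have hz : ∀ w, form e w z = t * a * coord e 2 w + t * b * coord e 3 w + b * coord e 0 w - a * coord e 1 w := by
    intro w
    simp only [z, map_add, map_sub, map_smul, form_vec, smul_eq_mul]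
    rfl
  have := h z (by rw [hz, h0, h1, h2, h3]; ring) (by
    rw [hz, ← ha, ← hb]
    simp only [t]
    field_simp
    ring)
  rw [h2, h3] at this
  exact hab (by linarith)

/-- A linear similarity `L` of `form` that preserves, up to a factor, the quantity
`((dx₃ ∧ dx₂) (u, v))²` on isotropic planes preserves the subspace `x₂ = x₃ = 0`. For isotropic
vectors of the subspace this is immediate; the rest follows because the `L`-preimages of `vec e 0`
and `vec e 1` are in the span of `vec e 0` and `vec e 1`, hence orthogonal to the subspace. -/
theorem kernel_of_conformal {c : ℝ} (hc : c ≠ 0) {L : EuclideanSpace ℝ ι →L[ℝ] EuclideanSpace ℝ ι}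
    (hL : ∀ u v, form e (L u) (L v) = c * form e u v)
    (hW : ∀ u v, form e u u = 0 → form e u v = 0 → form e v v = 0 →
      (coord e 3 (L u) * coord e 2 (L v) - coord e 2 (L u) * coord e 3 (L v)) ^ 2 =
        c * (coord e 3 u * coord e 2 v - coord e 2 u * coord e 3 v) ^ 2)
    {u : EuclideanSpace ℝ ι} (h2 : coord e 2 u = 0) (h3 : coord e 3 u = 0) :
    coord e 2 (L u) = 0 ∧ coord e 3 (L u) = 0 := by
  have hsurj := surjective_of_conformal e hc hL
  -- the claim for isotropic vectors
  have iso : ∀ u, form e u u = 0 → coord e 2 u = 0 → coord e 3 u = 0 →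
      coord e 2 (L u) = 0 ∧ coord e 3 (L u) = 0 := by
    intro u hu h2 h3
    refine eq_zero_of_isotropic_plane e fun z hz huz => ?_
    obtain ⟨v, rfl⟩ := hsurj z
    rw [hL] at hz huz
    have := hW u v hu ((mul_eq_zero.1 huz).resolve_left hc) ((mul_eq_zero.1 hz).resolve_left hc)
    rw [h2, h3] at this
    have : coord e 3 (L u) * coord e 2 (L v) - coord e 2 (L u) * coord e 3 (L v) = 0 := by
      simpa using this
    linarith
  -- the preimage of an isotropic vector `vec k`, `k = 0, 1`
  have key : ∀ k : Fin 4, k = 0 ∨ k = 1 → coord e (k + 2) (L u) = 0 := by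
    intro k hk
    obtain ⟨a, ha⟩ := hsurj (vec e k)
    have hkk : ∀ w, c * form e w a = coord e (k + 2) (L w) := by
      intro w
      rw [← hL, ha, form_vec]
    have hK : ∀ j : Fin 4, coord e (k + 2) (L (vec e j)) = 0 → coord e (j + 2) a = 0 := by
      intro j hj
      have := hkk (vec e j)
      rw [hj, form_comm, form_vec] at this
      exact (mul_eq_zero.1 this).resolve_left hc
    have hv : ∀ j : Fin 4, j = 0 ∨ j = 1 → coord e (j + 2) a = 0 := by
      intro j hj
      refine hK j ?_
      have := iso (vec e j) (by rcases hj with rfl | rfl <;> simp [form_vec, coord_vec])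
        (by rcases hj with rfl | rfl <;> simp [coord_vec]) (by rcases hj with rfl | rfl <;> simp [coord_vec])
      rcases hk with rfl | rfl
      · exact this.1
      · exact this.2
    have a2 : coord e 2 a = 0 := hv 0 (Or.inl rfl)
    have a3 : coord e 3 a = 0 := hv 1 (Or.inr rfl)
    have haa : form e a a = 0 := by
      have := hkk a
      rw [ha, coord_vec] at this
      have h' : (if k + 2 = k then (1 : ℝ) else 0) = 0 := by
        rcases hk with rfl | rfl <;> simp
      rw [h'] at this
      exact (mul_eq_zero.1 this).resolve_left hc
    have hf : ∀ j, coord e j (signFlip e a) = 0 := by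
      intro j
      simp [coord_apply, signFlip]
    have hff : form e (signFlip e a) (signFlip e a) = 0 := by
      rw [form_apply] at haa ⊢
      simp only [hf, a2, a3, mul_zero, zero_mul, zero_add] at haa ⊢
      rw [← haa]
      refine Finset.sum_congr rfl fun i _ => ?_
      simp only [signFlip]
      linear_combination (a i) ^ 2 * sgn_cube e i
    have h4 : form e (signFlip e a) a = 0 := by
      have := hkk (signFlip e a)
      have h5 := iso _ hff (hf 2) (hf 3)
      rcases hk with rfl | rfl
      · exact (mul_eq_zero.1 (this.trans h5.1)).resolve_left hc
      · exact (mul_eq_zero.1 (this.trans h5.2)).resolve_left hc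
    have h6 : ∀ i, sgn e i * a i = 0 := by
      rw [form_apply] at h4
      simp only [hf, a2, a3, mul_zero, zero_mul, zero_add] at h4
      have := (Finset.sum_eq_zero_iff_of_nonneg (fun i _ => by
        simp only [signFlip]
        nlinarith [sq_nonneg (sgn e i * a i)])).1 h4
      intro i
      have := this i (Finset.mem_univ _)
      simp only [signFlip] at this
      exact pow_eq_zero_iff (two_ne_zero) |>.1 (by linarith)
    rw [← hkk, form_apply, a2, a3, h2, h3]
    simp only [mul_zero, zero_mul, zero_add]
    rw [Finset.sum_eq_zero, mul_zero]
    intro i _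
    linear_combination u i * h6 i
  exact ⟨key 0 (Or.inl rfl), key 1 (Or.inr rfl)⟩

end

/-! ### The plane wave and its conformal curvature -/

section

section DirDeriv

variable {V : Type*} [NormedAddCommGroup V] [NormedSpace ℝ V]
  {G : Type*} [NormedAddCommGroup G] [NormedSpace ℝ G]
  {G₁ : Type*} [NormedAddCommGroup G₁] [NormedSpace ℝ G₁]
  {G₂ : Type*} [NormedAddCommGroup G₂] [NormedSpace ℝ G₂]
  {U : Set V}

/-- The derivative of `f` in the direction of the constant vector field `a`. -/
def dirDeriv (a : V) (f : V → G) : V → G := fun y => fderiv ℝ f y a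

theorem contDiffOn_dirDeriv (hU : IsOpen U) {f : V → G} (hf : ContDiffOn ℝ ∞ f U) (a : V) :
    ContDiffOn ℝ ∞ (dirDeriv a f) U :=
  (hf.fderiv_of_isOpen hU (m := ∞) (by simp)).clm_apply contDiffOn_const

theorem differentiableAt_of_contDiffOn (hU : IsOpen U) {f : V → G} (hf : ContDiffOn ℝ ∞ f U) {x : V}
    (hx : x ∈ U) : DifferentiableAt ℝ f x :=
  (hf.contDiffAt (hU.mem_nhds hx)).differentiableAt (by simp)

theorem dirDeriv_congr (hU : IsOpen U) {f g : V → G} (h : EqOn f g U) (a : V) :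
    EqOn (dirDeriv a f) (dirDeriv a g) U := fun x hx => by
  have : f =ᶠ[𝓝 x] g := Filter.eventually_of_mem (hU.mem_nhds hx) h
  simp [dirDeriv, this.fderiv_eq]

theorem dirDeriv_add (hU : IsOpen U) {f g : V → G} (hf : ContDiffOn ℝ ∞ f U)
    (hg : ContDiffOn ℝ ∞ g U) (a : V) :
    EqOn (dirDeriv a fun y => f y + g y) (fun y => dirDeriv a f y + dirDeriv a g y) U := fun x hx => by
  simp only [dirDeriv]
  rw [fderiv_fun_add (differentiableAt_of_contDiffOn hU hf hx) (differentiableAt_of_contDiffOn hU hg hx)]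
  rfl

theorem dirDeriv_clm (hU : IsOpen U) (L : G →L[ℝ] G₁) {f : V → G} (hf : ContDiffOn ℝ ∞ f U) (a : V) :
    EqOn (dirDeriv a fun y => L (f y)) (fun y => L (dirDeriv a f y)) U := fun x hx => by
  have := (L.hasFDerivAt.comp x (differentiableAt_of_contDiffOn hU hf hx).hasFDerivAt).fderiv
  simp only [dirDeriv]
  change fderiv ℝ (L ∘ f) x a = _
  rw [this]
  rfl

theorem dirDeriv_comm (hU : IsOpen U) {f : V → G} (hf : ContDiffOn ℝ ∞ f U) (a b : V) {x : V}
    (hx : x ∈ U) : dirDeriv a (dirDeriv b f) x = dirDeriv b (dirDeriv a f) x := by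
  have h1 : ∀ a b, dirDeriv a (dirDeriv b f) x = fderiv ℝ (fderiv ℝ f) x a b := by
    intro a b
    have hd : DifferentiableAt ℝ (fderiv ℝ f) x :=
      differentiableAt_of_contDiffOn hU (hf.fderiv_of_isOpen hU (m := ∞) (by simp)) hx
    change fderiv ℝ (fun y => fderiv ℝ f y b) x a = _
    rw [fderiv_clm_apply hd (differentiableAt_const b)]
    simp
  rw [h1, h1]
  exact (hf.contDiffAt (hU.mem_nhds hx)).isSymmSndFDerivAt
    (by simpa using WithTop.coe_le_coe.2 (le_top : (2 : ℕ∞) ≤ ⊤)) a b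

theorem contDiffOn_bilin (B : G₁ →L[ℝ] G₂ →L[ℝ] G) {f : V → G₁} {g : V → G₂}
    (hf : ContDiffOn ℝ ∞ f U) (hg : ContDiffOn ℝ ∞ g U) : ContDiffOn ℝ ∞ (fun y => B (f y) (g y)) U :=
  (B.contDiff.comp_contDiffOn hf).clm_apply hg

/-- The Leibniz rule for a continuous bilinear map. -/
theorem dirDeriv_bilin (hU : IsOpen U) (B : G₁ →L[ℝ] G₂ →L[ℝ] G) {f : V → G₁} {g : V → G₂}
    (hf : ContDiffOn ℝ ∞ f U) (hg : ContDiffOn ℝ ∞ g U) (a : V) :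
    EqOn (dirDeriv a fun y => B (f y) (g y))
      (fun y => B (dirDeriv a f y) (g y) + B (f y) (dirDeriv a g y)) U := fun x hx => by
  simp only [dirDeriv]
  rw [(B.hasFDerivAt_of_bilinear (differentiableAt_of_contDiffOn hU hf hx).hasFDerivAt
    (differentiableAt_of_contDiffOn hU hg hx).hasFDerivAt).fderiv]
  simp [add_comm]

theorem dirDeriv_dirDeriv_bilin (hU : IsOpen U) (B : G₁ →L[ℝ] G₂ →L[ℝ] G) {f : V → G₁} {g : V → G₂}
    (hf : ContDiffOn ℝ ∞ f U) (hg : ContDiffOn ℝ ∞ g U) (a b : V) {x : V} (hx : x ∈ U) :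
    dirDeriv b (dirDeriv a fun y => B (f y) (g y)) x =
      B (dirDeriv b (dirDeriv a f) x) (g x) + B (dirDeriv a f x) (dirDeriv b g x) +
        (B (dirDeriv b f x) (dirDeriv a g x) + B (f x) (dirDeriv b (dirDeriv a g) x)) := by
  have hfa := contDiffOn_dirDeriv hU hf a
  have hga := contDiffOn_dirDeriv hU hg a
  rw [dirDeriv_congr hU (dirDeriv_bilin hU B hf hg a) b hx,
    dirDeriv_add hU (contDiffOn_bilin B hfa hg) (contDiffOn_bilin B hf hga) b hx]
  simp only []
  rw [dirDeriv_bilin hU B hfa hg b hx, dirDeriv_bilin hU B hf hga b hx]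

/-- The first two derivatives of `q² X` at a zero of `q`. -/
theorem dirDeriv_sq_mul (hU : IsOpen U) {q X : V → ℝ} (hq : ContDiffOn ℝ ∞ q U)
    (hX : ContDiffOn ℝ ∞ X U) (a b : V) {x : V} (hx : x ∈ U) (h0 : q x = 0) :
    dirDeriv a (fun y => q y * q y * X y) x = 0 ∧
      dirDeriv b (dirDeriv a fun y => q y * q y * X y) x =
        2 * (dirDeriv a q x * dirDeriv b q x) * X x := by
  let B := ContinuousLinearMap.mul ℝ ℝ
  have hqq : ContDiffOn ℝ ∞ (fun y => q y * q y) U := contDiffOn_bilin B hq hq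
  have h1 := dirDeriv_bilin hU B hqq hX a hx
  have h2 := dirDeriv_dirDeriv_bilin hU B hqq hX a b hx
  have h3 := fun a => dirDeriv_bilin hU B hq hq a hx
  have h4 := dirDeriv_dirDeriv_bilin hU B hq hq a b hx
  simp only [B, ContinuousLinearMap.mul_apply'] at h1 h2 h3 h4
  rw [h1, h2, h3, h3, h4]
  simp only [h0]
  constructor <;> ring

end DirDeriv

variable {ι : Type*} [Fintype ι] {r s : ℕ} (e : Fin 4 ⊕ (Fin r ⊕ Fin s) ≃ ι)

/-- The metric `form + ε x₃² dx₂²` at the point `x`: a conformally curved plane wave for `ε = 1`,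
and the flat metric for `ε = 0`. -/
def metric (ε : ℝ) (x : EuclideanSpace ℝ ι) : EuclideanSpace ℝ ι →L[ℝ] EuclideanSpace ℝ ι →L[ℝ] ℝ :=
  form e + (ε * coord e 3 x ^ 2) • (coord e 2).smulRight (coord e 2)

theorem metric_apply (ε : ℝ) (x u v : EuclideanSpace ℝ ι) :
    metric e ε x u v = form e u v + ε * coord e 3 x ^ 2 * (coord e 2 u * coord e 2 v) := by
  simp [metric]

variable [DecidableEq ι]

/-- The conformal covariance of the curvature on isotropic planes, for a conformal map `F` from the
metric with `ε = 1` to the one with parameter `ε`. At points with `x₃ = 0` the first derivatives of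
the metrics vanish, and the curvature `R (u, v, u, v)` is the square of `(dx₃ ∧ dx₂) (u, v)` up to
a constant. The identity is the combination of the second derivatives of `F^* g = c g` in which the
third derivatives of `F` cancel; the second derivatives of `F` and of `c` drop out because `u` and
`v` span an isotropic plane. -/
theorem curvature_at_origin {U : Set (EuclideanSpace ℝ ι)} (hU : IsOpen U) {x : EuclideanSpace ℝ ι}
    (hx : x ∈ U) {ε : ℝ} {F : EuclideanSpace ℝ ι → EuclideanSpace ℝ ι} {c : EuclideanSpace ℝ ι → ℝ}
    (hF : ContDiffOn ℝ ∞ F U) (hc : ContDiffOn ℝ ∞ c U) (hc0 : c x ≠ 0)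
    (hx3 : coord e 3 x = 0) (hF3 : coord e 3 (F x) = 0)
    (h : ∀ y ∈ U, ∀ u v, metric e ε (F y) (fderiv ℝ F y u) (fderiv ℝ F y v) =
      c y * metric e 1 y u v)
    {u v : EuclideanSpace ℝ ι} (huu : form e u u = 0) (huv : form e u v = 0)
    (hvv : form e v v = 0) :
    ε * (coord e 3 (fderiv ℝ F x u) * coord e 2 (fderiv ℝ F x v) -
        coord e 2 (fderiv ℝ F x u) * coord e 3 (fderiv ℝ F x v)) ^ 2 =
      c x * (coord e 3 u * coord e 2 v - coord e 2 u * coord e 3 v) ^ 2 := by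
  let Q : EuclideanSpace ℝ ι → ℝ := fun y => coord e 3 (F y)
  have hQ : ContDiffOn ℝ ∞ Q U := (coord e 3).contDiff.comp_contDiffOn hF
  have hdF := fun a => contDiffOn_dirDeriv hU hF a
  have hdQ : ∀ a, dirDeriv a Q x = coord e 3 (dirDeriv a F x) :=
    fun a => dirDeriv_clm hU (coord e 3) hF a hx
  let p : EuclideanSpace ℝ ι → EuclideanSpace ℝ ι → EuclideanSpace ℝ ι → ℝ :=
    fun a b y => form e (dirDeriv a F y) (dirDeriv b F y)
  let X : EuclideanSpace ℝ ι → EuclideanSpace ℝ ι → EuclideanSpace ℝ ι → ℝ :=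
    fun a b y => ε * (coord e 2 (dirDeriv a F y) * coord e 2 (dirDeriv b F y))
  let z : EuclideanSpace ℝ ι → ℝ := fun y => coord e 3 y
  let k : EuclideanSpace ℝ ι → EuclideanSpace ℝ ι → EuclideanSpace ℝ ι → ℝ :=
    fun a b y => form e a b + z y * z y * (coord e 2 a * coord e 2 b)
  have hz : ContDiffOn ℝ ∞ z U := (coord e 3).contDiff.contDiffOn
  have hdz : ∀ a, dirDeriv a z x = coord e 3 a := by
    intro a
    simp [z, dirDeriv]
  have hp : ∀ a b, ContDiffOn ℝ ∞ (p a b) U := fun a b => contDiffOn_bilin _ (hdF a) (hdF b)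
  have hX : ∀ a b, ContDiffOn ℝ ∞ (X a b) U := fun a b =>
    contDiffOn_const.mul (((coord e 2).contDiff.comp_contDiffOn (hdF a)).mul
      ((coord e 2).contDiff.comp_contDiffOn (hdF b)))
  have hQX : ∀ a b, ContDiffOn ℝ ∞ (fun y => Q y * Q y * X a b y) U := fun a b =>
    (hQ.mul hQ).mul (hX a b)
  have hzz : ∀ a b, ContDiffOn ℝ ∞ (fun y => z y * z y * (coord e 2 a * coord e 2 b)) U :=
    fun a b => (hz.mul hz).mul contDiffOn_const
  have hk : ∀ a b, ContDiffOn ℝ ∞ (k a b) U := fun a b => contDiffOn_const.add (hzz a b)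
  -- the equation, and its first two derivatives at `x`
  have E0 : ∀ a b, EqOn (fun y => p a b y + Q y * Q y * X a b y) (fun y => c y * k a b y) U := by
    intro a b y hy
    have := h y hy a b
    rw [metric_apply, metric_apply] at this
    simp only [p, X, k, Q, z, dirDeriv]
    linear_combination this
  have dk : ∀ a b w, dirDeriv w (k a b) x = 0 := by
    intro a b w
    rw [dirDeriv_add hU contDiffOn_const (hzz a b) w hx]
    simp only []
    rw [(dirDeriv_sq_mul hU hz contDiffOn_const w w hx hx3).1]
    simp [dirDeriv]
  have ddk : ∀ a b w w', dirDeriv w' (dirDeriv w (k a b)) x =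
      2 * (coord e 3 w * coord e 3 w') * (coord e 2 a * coord e 2 b) := by
    intro a b w w'
    rw [dirDeriv_congr hU (dirDeriv_add hU contDiffOn_const (hzz a b) w) w' hx,
      dirDeriv_add hU (contDiffOn_dirDeriv hU contDiffOn_const w)
        (contDiffOn_dirDeriv hU (hzz a b) w) w' hx]
    simp only []
    rw [(dirDeriv_sq_mul hU hz contDiffOn_const w w' hx hx3).2, hdz, hdz]
    have : (dirDeriv w fun _ : EuclideanSpace ℝ ι => form e a b) = fun _ => 0 := by
      ext y; simp [dirDeriv]
    rw [this]
    simp [dirDeriv]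
  have hkx : ∀ a b, k a b x = form e a b := by
    intro a b
    have : z x = 0 := hx3
    simp [k, this]
  have E1 : ∀ a b w, form e (dirDeriv w (dirDeriv a F) x) (dirDeriv b F x) +
      form e (dirDeriv a F x) (dirDeriv w (dirDeriv b F) x) = dirDeriv w c x * form e a b := by
    intro a b w
    have := dirDeriv_congr hU (E0 a b) w hx
    rw [dirDeriv_add hU (hp a b) (hQX a b) w hx] at this
    simp only [] at this
    rw [(dirDeriv_sq_mul hU hQ (hX a b) w w hx hF3).1, dirDeriv_bilin hU _ (hdF a) (hdF b) w hx] at this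
    have h2 := dirDeriv_bilin hU (ContinuousLinearMap.mul ℝ ℝ) hc (hk a b) w hx
    simp only [ContinuousLinearMap.mul_apply'] at h2
    rw [h2, dk, hkx] at this
    linear_combination this
  have E2 : ∀ a b w w', form e (dirDeriv w' (dirDeriv w (dirDeriv a F)) x) (dirDeriv b F x) +
      form e (dirDeriv w (dirDeriv a F) x) (dirDeriv w' (dirDeriv b F) x) +
      form e (dirDeriv w' (dirDeriv a F) x) (dirDeriv w (dirDeriv b F) x) +
      form e (dirDeriv a F x) (dirDeriv w' (dirDeriv w (dirDeriv b F)) x) +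
      2 * (coord e 3 (dirDeriv w F x) * coord e 3 (dirDeriv w' F x)) *
        (ε * (coord e 2 (dirDeriv a F x) * coord e 2 (dirDeriv b F x))) =
      dirDeriv w' (dirDeriv w c) x * form e a b +
        c x * (2 * (coord e 3 w * coord e 3 w') * (coord e 2 a * coord e 2 b)) := by
    intro a b w w'
    have := dirDeriv_congr hU (dirDeriv_congr hU (E0 a b) w) w' hx
    rw [dirDeriv_congr hU (dirDeriv_add hU (hp a b) (hQX a b) w) w' hx,
      dirDeriv_add hU (contDiffOn_dirDeriv hU (hp a b) w)
        (contDiffOn_dirDeriv hU (hQX a b) w) w' hx] at this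
    simp only [] at this
    rw [(dirDeriv_sq_mul hU hQ (hX a b) w w' hx hF3).2,
      dirDeriv_dirDeriv_bilin hU _ (hdF a) (hdF b) w w' hx, hdQ, hdQ] at this
    have h2 := dirDeriv_dirDeriv_bilin hU (ContinuousLinearMap.mul ℝ ℝ) hc (hk a b) w w' hx
    simp only [ContinuousLinearMap.mul_apply'] at h2
    rw [h2, dk, dk, ddk, hkx] at this
    linear_combination this
  -- the differential is a similarity of `form`
  have hL : ∀ a b, form e (fderiv ℝ F x a) (fderiv ℝ F x b) = c x * form e a b := by
    intro a b
    have := E0 a b hx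
    have hQx : Q x = 0 := hF3
    simp only [hkx, hQx, p, dirDeriv] at this
    linear_combination this
  have hL' : ∀ a b, form e (dirDeriv a F x) (dirDeriv b F x) = c x * form e a b := hL
  have hsurj := surjective_of_conformal e hc0 hL
  have comm := fun a b => dirDeriv_comm hU hF a b hx
  have sym := form_comm e
  -- the second derivatives on the isotropic plane, paired with the image of the differential
  have S : ∀ a b, form e a a = 0 → form e a b = 0 → form e b b = 0 → ∀ w,
      2 * form e (dirDeriv a (dirDeriv b F) x) (dirDeriv w F x) =
        dirDeriv a c x * form e b w + dirDeriv b c x * form e a w := by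
    intro a b haa hab hbb w
    have h1 := E1 b w a
    have h2 := E1 a w b
    have h3 := E1 a b w
    rw [hab, mul_zero] at h3
    rw [comm w a, comm w b] at h3
    rw [comm b a] at h2
    rw [sym (dirDeriv b F x)] at h1
    rw [sym (dirDeriv a F x)] at h2
    rw [sym (dirDeriv a F x)] at h3
    linear_combination h1 + h2 - h3
  have S0 : ∀ a b a' b', (a = u ∨ a = v) → (b = u ∨ b = v) → (a' = u ∨ a' = v) →
      (b' = u ∨ b' = v) →
      form e (dirDeriv a (dirDeriv b F) x) (dirDeriv a' (dirDeriv b' F) x) = 0 := by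
    have iso : ∀ a b, (a = u ∨ a = v) → (b = u ∨ b = v) → form e a b = 0 := by
      rintro a b (rfl | rfl) (rfl | rfl)
      · exact huu
      · exact huv
      · rw [sym]; exact huv
      · exact hvv
    intro a b a' b' ha hb ha' hb'
    obtain ⟨w, hw⟩ := hsurj (dirDeriv a' (dirDeriv b' F) x)
    have h1 := S a b (iso a a ha ha) (iso a b ha hb) (iso b b hb hb) w
    have h2 : ∀ t, (t = u ∨ t = v) → form e t w = 0 := by
      intro t ht
      have h3 := S a' b' (iso a' a' ha' ha') (iso a' b' ha' hb') (iso b' b' hb' hb') t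
      rw [iso _ _ hb' ht, iso _ _ ha' ht, ← hw] at h3
      have h4 := hL w t
      rw [sym w t] at h4
      have h5 : c x * form e t w = 0 := by
        rw [← h4]
        change form e (fderiv ℝ F x w) (dirDeriv t F x) = 0
        linarith
      exact (mul_eq_zero.1 h5).resolve_left hc0
    have hw' : dirDeriv w F x = dirDeriv a' (dirDeriv b' F) x := hw
    rw [h2 a ha, h2 b hb, hw'] at h1
    linarith
  have hu : u = u ∨ u = v := Or.inl rfl
  have hv : v = u ∨ v = v := Or.inr rfl
  have K1 := E2 v v u u
  have K2 := E2 u u v v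
  have K3 := E2 u v u v
  have K4 := E2 u v v u
  -- third derivatives do not depend on the order of differentiation
  have T1 : dirDeriv u (dirDeriv u (dirDeriv v F)) x = dirDeriv v (dirDeriv u (dirDeriv u F)) x := by
    rw [dirDeriv_congr hU (fun y hy => dirDeriv_comm hU hF u v hy) u hx, dirDeriv_comm hU (hdF u) u v hx]
  have T2 : dirDeriv v (dirDeriv v (dirDeriv u F)) x = dirDeriv u (dirDeriv v (dirDeriv v F)) x := by
    rw [dirDeriv_congr hU (fun y hy => dirDeriv_comm hU hF v u hy) v hx, dirDeriv_comm hU (hdF v) v u hx]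
  have T3 : dirDeriv u (dirDeriv v (dirDeriv u F)) x = dirDeriv v (dirDeriv u (dirDeriv u F)) x :=
    dirDeriv_comm hU (hdF u) u v hx
  have T4 : dirDeriv v (dirDeriv u (dirDeriv v F)) x = dirDeriv u (dirDeriv v (dirDeriv v F)) x :=
    dirDeriv_comm hU (hdF v) v u hx
  rw [T1] at K1
  rw [T2] at K2
  rw [T4] at K3
  rw [T3] at K4
  simp only [S0 _ _ _ _ hu hv hu hv, S0 _ _ _ _ hv hu hu hv,
    S0 _ _ _ _ hv hu hv hu, S0 _ _ _ _ hu hu hv hv,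
    huu, huv, hvv] at K1 K2 K3 K4
  have Y1 := sym (dirDeriv v F x) (dirDeriv v (dirDeriv u (dirDeriv u F)) x)
  have Y2 := sym (dirDeriv u F x) (dirDeriv u (dirDeriv v (dirDeriv v F)) x)
  change ε * (coord e 3 (dirDeriv u F x) * coord e 2 (dirDeriv v F x) -
        coord e 2 (dirDeriv u F x) * coord e 3 (dirDeriv v F x)) ^ 2 = _
  linear_combination (K1 + K2 - K3 - K4) / 2 - Y1 / 2 + Y2 / 2

/-- An isometry of the metric with parameter `ε` that translates the coordinate `x₃` by `k`. -/
def boost (ε k : ℝ) (z : EuclideanSpace ℝ ι) : EuclideanSpace ℝ ι :=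
  z + k • vec e 3 - (ε * (k * (coord e 3 z * coord e 2 z) + k ^ 2 / 2 * coord e 2 z)) • vec e 0 +
    (ε * (k / 2 * (coord e 2 z * coord e 2 z))) • vec e 1

theorem hasFDerivAt_boost (ε k : ℝ) (z : EuclideanSpace ℝ ι) :
    HasFDerivAt (boost e ε k) (ContinuousLinearMap.id ℝ (EuclideanSpace ℝ ι) -
      (ε • (k • (coord e 3 z • coord e 2 + coord e 2 z • coord e 3) +
        (k ^ 2 / 2) • coord e 2)).smulRight (vec e 0) +
      (ε • ((k / 2) • (coord e 2 z • coord e 2 + coord e 2 z • coord e 2))).smulRight (vec e 1)) z := by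
  have h2 := (coord e 2).hasFDerivAt (x := z)
  have h3 := (coord e 3).hasFDerivAt (x := z)
  exact (((hasFDerivAt_id z).add_const (k • vec e 3)).sub
    ((((h3.mul h2).const_mul k).add (h2.const_mul (k ^ 2 / 2))).const_mul ε |>.smul_const (vec e 0))).add
    (((h2.mul h2).const_mul (k / 2)).const_mul ε |>.smul_const (vec e 1))

theorem contDiff_boost (ε k : ℝ) : ContDiff ℝ ∞ (boost e ε k) := by
  unfold boost
  fun_prop

theorem fderiv_boost_apply (ε k : ℝ) (z a : EuclideanSpace ℝ ι) :
    fderiv ℝ (boost e ε k) z a = a -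
      (ε * (k * (coord e 3 z * coord e 2 a + coord e 2 z * coord e 3 a) +
        k ^ 2 / 2 * coord e 2 a)) • vec e 0 + (ε * (k * coord e 2 z * coord e 2 a)) • vec e 1 := by
  rw [(hasFDerivAt_boost e ε k z).fderiv]
  simp only [add_apply, sub_apply, ContinuousLinearMap.smulRight_apply, smul_apply,
    ContinuousLinearMap.id_apply, smul_eq_mul]
  congr 3
  ring

theorem coord_two_fderiv_boost (ε k : ℝ) (z a : EuclideanSpace ℝ ι) :
    coord e 2 (fderiv ℝ (boost e ε k) z a) = coord e 2 a := by
  simp [fderiv_boost_apply, coord_vec]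

theorem coord_three_fderiv_boost (ε k : ℝ) (z a : EuclideanSpace ℝ ι) :
    coord e 3 (fderiv ℝ (boost e ε k) z a) = coord e 3 a := by
  simp [fderiv_boost_apply, coord_vec]

theorem coord_three_boost (ε k : ℝ) (z : EuclideanSpace ℝ ι) :
    coord e 3 (boost e ε k z) = coord e 3 z + k := by
  simp [boost, coord_vec]

theorem metric_boost (ε k : ℝ) (z a b : EuclideanSpace ℝ ι) :
    metric e ε (boost e ε k z) (fderiv ℝ (boost e ε k) z a) (fderiv ℝ (boost e ε k) z b) =
      metric e ε z a b := by
  have f0 : ∀ w, form e w (vec e 0) = coord e 2 w := fun w => form_vec e w 0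
  have f1 : ∀ w, form e w (vec e 1) = coord e 3 w := fun w => form_vec e w 1
  have g0 : ∀ w, form e (vec e 0) w = coord e 2 w := fun w => by rw [form_comm, f0]
  have g1 : ∀ w, form e (vec e 1) w = coord e 3 w := fun w => by rw [form_comm, f1]
  rw [metric_apply, metric_apply, coord_three_boost, coord_two_fderiv_boost, coord_two_fderiv_boost,
    fderiv_boost_apply, fderiv_boost_apply]
  simp only [map_add, map_sub, map_smul, add_apply, sub_apply, smul_apply, f0, f1, g0, g1,
    smul_eq_mul, coord_vec]
  simp
  ring

/-- A local isometry of the metric with `ε = 1` that maps the origin to `x`. The translation by a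
vector with `x₃ = 0` is an isometry, too. -/
def centeredChart (x z : EuclideanSpace ℝ ι) : EuclideanSpace ℝ ι :=
  (x - coord e 3 x • vec e 3) + boost e 1 (coord e 3 x) z

theorem centeredChart_zero (x : EuclideanSpace ℝ ι) : centeredChart e x 0 = x := by
  simp [centeredChart, boost]

theorem fderiv_centeredChart (x z : EuclideanSpace ℝ ι) :
    fderiv ℝ (centeredChart e x) z = fderiv ℝ (boost e 1 (coord e 3 x)) z := by
  change fderiv ℝ (fun z => _ + boost e 1 (coord e 3 x) z) z = _
  rw [fderiv_const_add]

theorem contDiff_centeredChart (x : EuclideanSpace ℝ ι) : ContDiff ℝ ∞ (centeredChart e x) :=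
  contDiff_const.add (contDiff_boost e _ _)

theorem metric_centeredChart (x z a b : EuclideanSpace ℝ ι) :
    metric e 1 (centeredChart e x z) (fderiv ℝ (centeredChart e x) z a)
      (fderiv ℝ (centeredChart e x) z b) = metric e 1 z a b := by
  rw [fderiv_centeredChart, ← metric_boost e 1 (coord e 3 x) z a b, metric_apply, metric_apply]
  simp [centeredChart, coord_vec]

/-- The conclusion of `curvature_at_origin` at an arbitrary point, for the differential `L` of the
conformal map after isometries that move the point and its image to `x₃ = 0`. -/
theorem exists_centered {U : Set (EuclideanSpace ℝ ι)} (hU : IsOpen U) {x : EuclideanSpace ℝ ι}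
    (hx : x ∈ U) {ε : ℝ} {F : EuclideanSpace ℝ ι → EuclideanSpace ℝ ι} {c : EuclideanSpace ℝ ι → ℝ}
    (hF : ContDiffOn ℝ ∞ F U) (hc : ContDiffOn ℝ ∞ c U) (hc0 : c x ≠ 0)
    (h : ∀ y ∈ U, ∀ u v, metric e ε (F y) (fderiv ℝ F y u) (fderiv ℝ F y v) =
      c y * metric e 1 y u v) :
    ∃ L : EuclideanSpace ℝ ι →L[ℝ] EuclideanSpace ℝ ι,
      (∀ u v, form e (L u) (L v) = c x * form e u v) ∧
      (∀ u v, form e u u = 0 → form e u v = 0 → form e v v = 0 →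
        ε * (coord e 3 (L u) * coord e 2 (L v) - coord e 2 (L u) * coord e 3 (L v)) ^ 2 =
          c x * (coord e 3 u * coord e 2 v - coord e 2 u * coord e 3 v) ^ 2) ∧
      ∀ u, coord e 2 u = 0 → coord e 2 (L u) = coord e 2 (fderiv ℝ F x u) ∧
        coord e 3 (L u) = coord e 3 (fderiv ℝ F x u) := by
  let T := centeredChart e x
  let S := boost e ε (- coord e 3 (F x))
  have hT0 : T 0 = x := centeredChart_zero e x
  have hT : ContDiff ℝ ∞ T := contDiff_centeredChart e x
  have hS : ContDiff ℝ ∞ S := contDiff_boost e _ _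
  have hU' : IsOpen (T ⁻¹' U) := hU.preimage hT.continuous
  have h0 : (0 : EuclideanSpace ℝ ι) ∈ T ⁻¹' U := by simpa [hT0] using hx
  have hFT : ContDiffOn ℝ ∞ (fun z => F (T z)) (T ⁻¹' U) :=
    hF.comp hT.contDiffOn fun z hz => hz
  have hF' : ContDiffOn ℝ ∞ (fun z => S (F (T z))) (T ⁻¹' U) := hS.comp_contDiffOn hFT
  have hc' : ContDiffOn ℝ ∞ (fun z => c (T z)) (T ⁻¹' U) := hc.comp hT.contDiffOn fun z hz => hz
  have hd : ∀ z ∈ T ⁻¹' U, ∀ a, fderiv ℝ (fun z => S (F (T z))) z a =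
      fderiv ℝ S (F (T z)) (fderiv ℝ F (T z) (fderiv ℝ T z a)) := by
    intro z hz a
    have h1 := (hT.differentiable (by simp) z).hasFDerivAt
    have h2 := (differentiableAt_of_contDiffOn hU hF hz).hasFDerivAt
    have h3 := (hS.differentiable (by simp) (F (T z))).hasFDerivAt
    have := (h3.comp z (h2.comp z h1)).fderiv
    change fderiv ℝ (S ∘ F ∘ T) z a = _
    rw [this]
    rfl
  have heq : ∀ z ∈ T ⁻¹' U, ∀ a b, metric e ε (S (F (T z))) (fderiv ℝ (fun z => S (F (T z))) z a)
      (fderiv ℝ (fun z => S (F (T z))) z b) = c (T z) * metric e 1 z a b := by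
    intro z hz a b
    rw [hd z hz, hd z hz, metric_boost, h (T z) hz, metric_centeredChart]
  have hS3 : coord e 3 (S (F (T 0))) = 0 := by
    rw [hT0, coord_three_boost]
    ring
  refine ⟨fderiv ℝ (fun z => S (F (T z))) 0, ?_, ?_, ?_⟩
  · intro u v
    have := heq 0 h0 u v
    rw [metric_apply, metric_apply, hS3, map_zero, hT0] at this
    linear_combination this
  · intro u v huu huv hvv
    have := curvature_at_origin e hU' h0 hF' hc' (by rwa [hT0]) (map_zero _) hS3 heq huu huv hvv
    rwa [hT0] at this
  · intro u hu
    have h1 : fderiv ℝ T 0 u = u := by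
      rw [fderiv_centeredChart, fderiv_boost_apply, hu]
      simp
    rw [hd 0 h0, hT0, h1, coord_two_fderiv_boost, coord_three_fderiv_boost]
    exact ⟨rfl, rfl⟩

/-- The distribution `dx₂ = dx₃ = 0` is invariant under local conformal maps of the plane wave. -/
theorem kernel_of_conformal_map {U : Set (EuclideanSpace ℝ ι)} (hU : IsOpen U) {x : EuclideanSpace ℝ ι}
    (hx : x ∈ U) {F : EuclideanSpace ℝ ι → EuclideanSpace ℝ ι} {c : EuclideanSpace ℝ ι → ℝ}
    (hF : ContDiffOn ℝ ∞ F U) (hc : ContDiffOn ℝ ∞ c U) (hc0 : c x ≠ 0)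
    (h : ∀ y ∈ U, ∀ u v, metric e 1 (F y) (fderiv ℝ F y u) (fderiv ℝ F y v) =
      c y * metric e 1 y u v)
    {u : EuclideanSpace ℝ ι} (h2 : coord e 2 u = 0) (h3 : coord e 3 u = 0) :
    coord e 2 (fderiv ℝ F x u) = 0 ∧ coord e 3 (fderiv ℝ F x u) = 0 := by
  obtain ⟨L, hL, hW, hLu⟩ := exists_centered e hU hx hF hc hc0 h
  rw [← (hLu u h2).1, ← (hLu u h2).2]
  refine kernel_of_conformal e hc0 hL (fun u v huu huv hvv => ?_) h2 h3
  rw [← hW u v huu huv hvv, one_mul]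

/-- The plane wave is nowhere conformally flat. -/
theorem not_conformal_to_flat {U : Set (EuclideanSpace ℝ ι)} (hU : IsOpen U) {x : EuclideanSpace ℝ ι}
    (hx : x ∈ U) {F : EuclideanSpace ℝ ι → EuclideanSpace ℝ ι} {c : EuclideanSpace ℝ ι → ℝ}
    (hF : ContDiffOn ℝ ∞ F U) (hc : ContDiffOn ℝ ∞ c U) (hc0 : c x ≠ 0) :
    ¬ ∀ y ∈ U, ∀ u v, form e (fderiv ℝ F y u) (fderiv ℝ F y v) = c y * metric e 1 y u v := by
  intro h
  obtain ⟨L, -, hW, -⟩ := exists_centered e hU hx (ε := 0) hF hc hc0 (fun y hy u v => by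
    rw [metric_apply, ← h y hy]; ring)
  have := hW (vec e 2) (vec e 3) (by simp [form_vec, coord_vec]) (by simp [form_vec, coord_vec])
    (by simp [form_vec, coord_vec])
  simp [coord_vec] at this
  exact hc0 this.symm

end

/-! ### The homotheties and their orbits -/

section

variable {ι : Type*} [Fintype ι] {r s : ℕ} (e : Fin 4 ⊕ (Fin r ⊕ Fin s) ≃ ι)

/-- The weights of the two-parameter group of homotheties of the plane wave: `a + 2b`, `2a + b`,
`a`, `b` on the distinguished coordinates and `a + b` on all others, where `l = (a, b)`. -/
def weight (l : ℝ × ℝ) (i : ι) : ℝ :=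
  Sum.elim ![l.1 + 2 * l.2, 2 * l.1 + l.2, l.1, l.2] (fun _ => l.1 + l.2) (e.symm i)

theorem weight_add (l m : ℝ × ℝ) (i : ι) : weight e (l + m) i = weight e l i + weight e m i := by
  unfold weight
  rcases e.symm i with k | j
  · fin_cases k <;> simp <;> ring
  · simp; ring

theorem weight_smul (t : ℝ) (l : ℝ × ℝ) (i : ι) : weight e (t • l) i = t * weight e l i := by
  unfold weight
  rcases e.symm i with k | j
  · fin_cases k <;> simp <;> ring
  · simp; ring

theorem weight_pos {l : ℝ × ℝ} (h1 : 0 < l.1) (h2 : 0 < l.2) (i : ι) : 0 < weight e l i := by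
  unfold weight
  rcases e.symm i with k | j
  · fin_cases k <;> simp <;> linarith
  · simp; linarith

theorem contDiff_weight (i : ι) : ContDiff ℝ ω fun l => weight e l i := by
  unfold weight
  rcases e.symm i with k | j
  · fin_cases k <;> simp <;> fun_prop
  · simp; fun_prop

/-- The diagonal linear map with entries `d`. -/
def diag (d : ι → ℝ) : EuclideanSpace ℝ ι →L[ℝ] EuclideanSpace ℝ ι :=
  LinearMap.toContinuousLinearMap
    { toFun := fun x => WithLp.toLp 2 fun i => d i * x i
      map_add' := fun x y => by ext i; simp [mul_add]
      map_smul' := fun c x => by ext i; simp [mul_left_comm] }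

/-- The homothety of the plane wave with parameter `l`. -/
def dil (l : ℝ × ℝ) : EuclideanSpace ℝ ι →L[ℝ] EuclideanSpace ℝ ι :=
  diag fun i => Real.exp (weight e l i)

/-- The infinitesimal generator of `t ↦ dil e (t • l)`. -/
def gen (l : ℝ × ℝ) : EuclideanSpace ℝ ι →L[ℝ] EuclideanSpace ℝ ι := diag (weight e l)

theorem dil_apply (l : ℝ × ℝ) (x : EuclideanSpace ℝ ι) (i : ι) :
    dil e l x i = Real.exp (weight e l i) * x i := rfl

theorem gen_apply (l : ℝ × ℝ) (x : EuclideanSpace ℝ ι) (i : ι) :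
    gen e l x i = weight e l i * x i := rfl

theorem coord_dil (l : ℝ × ℝ) (x : EuclideanSpace ℝ ι) (k : Fin 4) :
    coord e k (dil e l x) = Real.exp (weight e l (e (.inl k))) * coord e k x := rfl

theorem dil_add (l m : ℝ × ℝ) (x : EuclideanSpace ℝ ι) : dil e (l + m) x = dil e l (dil e m x) := by
  ext i
  simp [dil_apply, weight_add, Real.exp_add, mul_assoc]

theorem weight_zero (i : ι) : weight e 0 i = 0 := by
  simpa using weight_smul e 0 0 i

theorem dil_zero (x : EuclideanSpace ℝ ι) : dil e 0 x = x := by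
  ext i
  simp [dil_apply, weight_zero]

theorem gen_dil (l m : ℝ × ℝ) (x : EuclideanSpace ℝ ι) : gen e l (dil e m x) = dil e m (gen e l x) := by
  ext i
  simp only [dil_apply, gen_apply]
  ring

theorem dil_ne_zero (l : ℝ × ℝ) {x : EuclideanSpace ℝ ι} (hx : x ≠ 0) : dil e l x ≠ 0 := by
  intro h
  apply hx
  rw [← dil_zero e x, ← neg_add_cancel l, dil_add, h, map_zero]

@[simp] theorem weight_inl_zero (l : ℝ × ℝ) : weight e l (e (.inl 0)) = l.1 + 2 * l.2 := by simp [weight]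
@[simp] theorem weight_inl_one (l : ℝ × ℝ) : weight e l (e (.inl 1)) = 2 * l.1 + l.2 := by simp [weight]
@[simp] theorem weight_inl_two (l : ℝ × ℝ) : weight e l (e (.inl 2)) = l.1 := by simp [weight]
@[simp] theorem weight_inl_three (l : ℝ × ℝ) : weight e l (e (.inl 3)) = l.2 := by simp [weight]

theorem form_dil (l : ℝ × ℝ) (u v : EuclideanSpace ℝ ι) :
    form e (dil e l u) (dil e l v) = Real.exp (2 * (l.1 + l.2)) * form e u v := by
  have hsum : ∑ i, sgn e i * (dil e l u i * dil e l v i) =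
      Real.exp (2 * (l.1 + l.2)) * ∑ i, sgn e i * (u i * v i) := by
    rw [Finset.mul_sum]
    refine Finset.sum_congr rfl fun i _ => ?_
    obtain ⟨j, rfl⟩ := e.surjective i
    rcases j with k | j
    · simp
    · have : weight e l (e (.inr j)) = l.1 + l.2 := by simp [weight]
      have h : Real.exp (2 * (l.1 + l.2)) = Real.exp (l.1 + l.2) * Real.exp (l.1 + l.2) := by
        rw [← Real.exp_add]; ring_nf
      rw [dil_apply, dil_apply, this, h]
      ring
  rw [form_apply, form_apply, hsum]
  simp only [coord_dil, weight_inl_zero, weight_inl_one, weight_inl_two, weight_inl_three]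
  have h1 : Real.exp (l.1 + 2 * l.2) * Real.exp l.1 = Real.exp (2 * (l.1 + l.2)) := by
    rw [← Real.exp_add]; ring_nf
  have h2 : Real.exp (2 * l.1 + l.2) * Real.exp l.2 = Real.exp (2 * (l.1 + l.2)) := by
    rw [← Real.exp_add]; ring_nf
  linear_combination (coord e 0 u * coord e 2 v + coord e 2 u * coord e 0 v) * h1 +
    (coord e 1 u * coord e 3 v + coord e 3 u * coord e 1 v) * h2

theorem metric_dil (l : ℝ × ℝ) (x u v : EuclideanSpace ℝ ι) :
    metric e 1 (dil e l x) (dil e l u) (dil e l v) =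
      Real.exp (2 * (l.1 + l.2)) * metric e 1 x u v := by
  rw [metric_apply, metric_apply, form_dil]
  simp only [coord_dil, weight_inl_three, weight_inl_two]
  have h : Real.exp (2 * (l.1 + l.2)) = Real.exp l.2 ^ 2 * (Real.exp l.1 * Real.exp l.1) := by
    rw [← Real.exp_add, ← Real.exp_nat_mul, ← Real.exp_add]
    push_cast; ring_nf
  rw [h]
  ring

/-- The derivative of `y ↦ dil e (t y • l) (f y)`. -/
theorem hasFDerivAt_dil_smul {X : Type*} [NormedAddCommGroup X] [NormedSpace ℝ X] {t : X → ℝ}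
    {f : X → EuclideanSpace ℝ ι} {t' : X →L[ℝ] ℝ} {f' : X →L[ℝ] EuclideanSpace ℝ ι} {x : X}
    (ht : HasFDerivAt t t' x) (hf : HasFDerivAt f f' x) (l : ℝ × ℝ) :
    HasFDerivAt (fun y => dil e (t y • l) (f y))
      ((dil e (t x • l)).comp (t'.smulRight (gen e l (f x)) + f')) x := by
  rw [← hasFDerivWithinAt_univ, hasFDerivWithinAt_euclidean]
  intro i
  rw [hasFDerivWithinAt_univ]
  have hfi : HasFDerivAt (fun y => f y i) ((EuclideanSpace.proj i).comp f') x :=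
    (EuclideanSpace.proj i : EuclideanSpace ℝ ι →L[ℝ] ℝ).hasFDerivAt.comp x hf
  simp only [dil_apply, weight_smul]
  refine (((ht.mul_const (weight e l i)).exp).mul hfi).congr_fderiv ?_
  ext u
  simp [dil_apply, gen_apply, weight_smul]
  ring

theorem contDiff_dil_smul {m : WithTop ℕ∞} (l : ℝ × ℝ) :
    ContDiff ℝ m fun p : ℝ × EuclideanSpace ℝ ι => dil e (p.1 • l) p.2 := by
  rw [contDiff_euclidean]
  intro i
  simp only [dil_apply, weight_smul]
  fun_prop

/-- The square of the norm of the point `dil e (-t • l) x` of the orbit of `x`. -/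
def radius (l : ℝ × ℝ) (x : EuclideanSpace ℝ ι) (t : ℝ) : ℝ := ‖dil e (-t • l) x‖ ^ 2

theorem radius_eq (l : ℝ × ℝ) (x : EuclideanSpace ℝ ι) (t : ℝ) :
    radius e l x t = ∑ i, Real.exp (-t * weight e l i) ^ 2 * x i ^ 2 := by
  rw [radius, EuclideanSpace.real_norm_sq_eq]
  simp only [dil_apply, weight_smul, mul_pow]

theorem contDiff_radius {m : WithTop ℕ∞} (l : ℝ × ℝ) :
    ContDiff ℝ m fun p : EuclideanSpace ℝ ι × ℝ => radius e l p.1 p.2 := by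
  simp only [radius_eq]
  fun_prop

variable {l : ℝ × ℝ} {x : EuclideanSpace ℝ ι}

theorem exists_apply_ne_zero (hx : x ≠ 0) : ∃ i, x i ≠ 0 := by
  by_contra! h
  exact hx (by ext i; simpa using h i)

theorem radius_strictAnti (hl : 0 < l.1 ∧ 0 < l.2) (hx : x ≠ 0) : StrictAnti (radius e l x) := by
  intro t t' htt
  obtain ⟨i, hi⟩ := exists_apply_ne_zero hx
  rw [radius_eq, radius_eq]
  have hlt : ∀ i, Real.exp (-t' * weight e l i) < Real.exp (-t * weight e l i) := fun i => by
    have := weight_pos e hl.1 hl.2 i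
    exact Real.exp_lt_exp.2 (by nlinarith)
  refine Finset.sum_lt_sum (fun i _ => ?_) ⟨i, Finset.mem_univ _, ?_⟩
  · exact mul_le_mul_of_nonneg_right (pow_le_pow_left₀ (Real.exp_pos _).le (hlt i).le 2) (sq_nonneg _)
  · have hi2 : 0 < x i ^ 2 := by positivity
    exact mul_lt_mul_of_pos_right (pow_lt_pow_left₀ (hlt i) (Real.exp_pos _).le two_ne_zero) hi2

theorem exists_radius_eq_one (hl : 0 < l.1 ∧ 0 < l.2) (hx : x ≠ 0) : ∃ t, radius e l x t = 1 := by
  have hc : Continuous fun t => radius e l x t := by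
    simp only [radius_eq]
    fun_prop
  have hlim : Filter.Tendsto (radius e l x) Filter.atTop (𝓝 0) := by
    have : Filter.Tendsto (fun t => ∑ i, Real.exp (-t * weight e l i) ^ 2 * x i ^ 2) Filter.atTop
        (𝓝 (∑ i : ι, 0 ^ 2 * x i ^ 2)) := by
      refine tendsto_finsetSum _ fun i _ => ((Real.tendsto_exp_atBot.comp ?_).pow 2).mul_const _
      exact (Filter.tendsto_neg_atTop_atBot).atBot_mul_const (weight_pos e hl.1 hl.2 i)
    refine Filter.Tendsto.congr (fun t => (radius_eq e l x t).symm) ?_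
    simpa using this
  obtain ⟨t, ht⟩ := (hlim.eventually (gt_mem_nhds one_pos)).exists
  obtain ⟨i, hi⟩ := exists_apply_ne_zero hx
  refine mem_range_of_exists_le_of_exists_ge hc ⟨t, ht.le⟩ ⟨Real.log |x i| / weight e l i, ?_⟩
  rw [radius_eq]
  set T := Real.log |x i| / weight e l i with hT
  have hi1 : Real.exp (-T * weight e l i) ^ 2 * x i ^ 2 = 1 := by
    have := (weight_pos e hl.1 hl.2 i).ne'
    rw [hT, neg_mul, div_mul_cancel₀ _ this, Real.exp_neg, Real.exp_log (abs_pos.2 hi), inv_pow,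
      sq_abs, inv_mul_cancel₀ (by positivity)]
  rw [← hi1]
  exact Finset.single_le_sum (f := fun i => Real.exp (-T * weight e l i) ^ 2 * x i ^ 2)
    (fun i _ => by positivity) (Finset.mem_univ i)

/-- The time `t` at which the flow `t ↦ dil e (t • l)` reaches `x` from the unit sphere. It exists
and is unique if both components of `l` are positive and `x ≠ 0`, the only case of interest. -/
def time (l : ℝ × ℝ) (x : EuclideanSpace ℝ ι) : ℝ := Function.invFun (radius e l x) 1

theorem radius_time (hl : 0 < l.1 ∧ 0 < l.2) (hx : x ≠ 0) : radius e l x (time e l x) = 1 :=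
  Function.invFun_eq (exists_radius_eq_one e hl hx)

theorem norm_dil_time (hl : 0 < l.1 ∧ 0 < l.2) (hx : x ≠ 0) : ‖dil e (-time e l x • l) x‖ = 1 :=
  (pow_eq_one_iff_of_nonneg (norm_nonneg _) two_ne_zero).1 (radius_time e hl hx)

theorem time_eq (hl : 0 < l.1 ∧ 0 < l.2) {t : ℝ} (h : ‖dil e (-t • l) x‖ = 1) : time e l x = t := by
  have hx : x ≠ 0 := by
    rintro rfl
    simp at h
  refine (radius_strictAnti e hl hx).injective ?_
  rw [radius_time e hl hx, radius, h, one_pow]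

/-- `time` is smooth by the implicit function theorem, as `radius` has a negative derivative in
`t`. -/
theorem contDiffAt_time (hl : 0 < l.1 ∧ 0 < l.2) (hx : x ≠ 0) : ContDiffAt ℝ ∞ (time e l) x := by
  let f : EuclideanSpace ℝ ι × ℝ → ℝ := fun p => radius e l p.1 p.2
  let u : EuclideanSpace ℝ ι × ℝ := (x, time e l x)
  have hf : ContDiff ℝ ∞ f := contDiff_radius e l
  have hu : f u = 1 := radius_time e hl hx
  let a : ℝ := ∑ i, 2 * Real.exp (-time e l x * weight e l i) ^ 2 * (-weight e l i) * x i ^ 2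
  have ha : a ≠ 0 := by
    refine (Finset.sum_neg' (fun i _ => ?_) ?_).ne
    · have := (weight_pos e hl.1 hl.2 i).le
      have : 0 ≤ 2 * Real.exp (-time e l x * weight e l i) ^ 2 * weight e l i * x i ^ 2 := by positivity
      linarith
    · obtain ⟨i, hi⟩ := exists_apply_ne_zero hx
      refine ⟨i, Finset.mem_univ _, ?_⟩
      have := weight_pos e hl.1 hl.2 i
      have : 0 < 2 * Real.exp (-time e l x * weight e l i) ^ 2 * weight e l i * x i ^ 2 := by positivity
      linarith
  have hderiv : HasDerivAt (fun t => radius e l x t) a (time e l x) := by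
    simp only [radius_eq]
    refine HasDerivAt.fun_sum fun i _ => ?_
    have h := ((((hasDerivAt_id (time e l x)).neg.mul_const (weight e l i)).exp).pow 2).mul_const
      (x i ^ 2)
    refine h.congr_deriv ?_
    simp only [Pi.neg_apply, id_eq, Nat.cast_ofNat, Nat.add_one_sub_one, pow_one]
    ring
  have hinv : (fderiv ℝ f u ∘L .inr ℝ (EuclideanSpace ℝ ι) ℝ).IsInvertible := by
    refine ⟨ContinuousLinearEquiv.unitsEquivAut ℝ (Units.mk0 a ha), ?_⟩
    have h1 : HasFDerivAt (fun t : ℝ => (x, t)) (.inr ℝ (EuclideanSpace ℝ ι) ℝ) (time e l x) :=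
      hasFDerivAt_prodMk_right x _
    have h2 := ((hf.differentiable (by simp) u).hasFDerivAt.comp (time e l x) h1).hasDerivAt.unique hderiv
    ext
    simpa using h2.symm
  have hf' : ContDiffAt ℝ ∞ f u := hf.contDiffAt
  have h := hf'.contDiffAt_implicitFunction (by simp) hinv
  refine h.congr_of_eventuallyEq ?_
  filter_upwards [hf'.eventually_apply_implicitFunction (by simp) hinv, isOpen_ne.mem_nhds hx] with y hy hy0
  refine (radius_strictAnti e hl hy0).injective ?_
  rw [radius_time e hl hy0, ← hu, ← hy]

/-- The point of the unit sphere on the orbit of `x` under the flow `t ↦ dil (t • l)`. -/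
def unitPoint (l : ℝ × ℝ) (x : EuclideanSpace ℝ ι) : EuclideanSpace ℝ ι := dil e (-time e l x • l) x

theorem norm_unitPoint (hl : 0 < l.1 ∧ 0 < l.2) (hx : x ≠ 0) : ‖unitPoint e l x‖ = 1 :=
  norm_dil_time e hl hx

theorem dil_unitPoint (l : ℝ × ℝ) (x : EuclideanSpace ℝ ι) :
    dil e (time e l x • l) (unitPoint e l x) = x := by
  rw [unitPoint, ← dil_add, neg_smul, add_neg_cancel, dil_zero]

theorem time_of_norm_eq_one (hl : 0 < l.1 ∧ 0 < l.2) (h : ‖x‖ = 1) : time e l x = 0 :=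
  time_eq e hl (by simpa [dil_zero] using h)

theorem time_dil_unitPoint (hl : 0 < l.1 ∧ 0 < l.2) (b : ℝ × ℝ) (hx : x ≠ 0) :
    time e l (dil e b (unitPoint e l x)) = time e l (dil e b x) - time e l x := by
  refine time_eq e hl ?_
  rw [unitPoint, ← dil_add, ← dil_add]
  convert! norm_dil_time e hl (dil_ne_zero e b hx) using 2
  rw [← dil_add]
  congr 2
  module

theorem unitPoint_dil_unitPoint (hl : 0 < l.1 ∧ 0 < l.2) (b : ℝ × ℝ) (hx : x ≠ 0) :
    unitPoint e l (dil e b (unitPoint e l x)) = unitPoint e l (dil e b x) := by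
  rw [unitPoint, time_dil_unitPoint e hl b hx, unitPoint, unitPoint, ← dil_add, ← dil_add, ← dil_add]
  congr 2
  module

theorem time_dil_smul (hl : 0 < l.1 ∧ 0 < l.2) (t : ℝ) (hx : x ≠ 0) :
    time e l (dil e (t • l) x) = time e l x + t := by
  refine time_eq e hl ?_
  have : -(time e l x + t) • l + t • l = -time e l x • l := by module
  rw [← dil_add, this]
  exact norm_dil_time e hl hx

theorem unitPoint_dil_smul (hl : 0 < l.1 ∧ 0 < l.2) (t : ℝ) (hx : x ≠ 0) :
    unitPoint e l (dil e (t • l) x) = unitPoint e l x := by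
  rw [unitPoint, time_dil_smul e hl t hx, unitPoint, ← dil_add]
  congr 2
  module

theorem contDiffAt_unitPoint (hl : 0 < l.1 ∧ 0 < l.2) (hx : x ≠ 0) :
    ContDiffAt ℝ ∞ (unitPoint e l) x :=
  (contDiff_dil_smul e l).contDiffAt.comp x ((contDiffAt_time e hl hx).neg.prodMk contDiffAt_id)

theorem fderiv_unitPoint (hl : 0 < l.1 ∧ 0 < l.2) (hx : x ≠ 0) (u : EuclideanSpace ℝ ι) :
    fderiv ℝ (unitPoint e l) x u = dil e (-time e l x • l) u -
      fderiv ℝ (time e l) x u • gen e l (unitPoint e l x) := by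
  have h1 := ((contDiffAt_time e hl hx).differentiableAt (by simp)).hasFDerivAt
  have := (hasFDerivAt_dil_smul e h1.neg (hasFDerivAt_id x) l).fderiv
  change fderiv ℝ (fun y => dil e (-time e l y • l) y) x u = _
  refine (congrArg (fun L => L u) this).trans ?_
  simp [unitPoint, gen_dil]
  abel

end

/-! ### The metrics on the product of the circle and the sphere -/

section

set_option synthInstance.maxHeartbeats 400000

/-- The unit sphere of `ℝ^(n+1)`. -/
abbrev Sph (n : ℕ) : Type := Metric.sphere (0 : EuclideanSpace ℝ (Fin (n + 1))) 1

variable {n r s : ℕ} (e : Fin 4 ⊕ (Fin r ⊕ Fin s) ≃ Fin (n + 1))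

theorem contMDiff_coe_circle {k : WithTop ℕ∞} :
    ContMDiff (𝓡 1) 𝓘(ℝ, ℂ) k (fun z : Circle => (z : ℂ)) := by
  have := finrank_real_complex_fact'
  exact contMDiff_coe_sphere

theorem contMDiff_coe_sph {k : WithTop ℕ∞} :
    ContMDiff (𝓡 n) 𝓘(ℝ, EuclideanSpace ℝ (Fin (n + 1))) k
      (fun w : Sph n => (w : EuclideanSpace ℝ (Fin (n + 1)))) := by
  have := Fact.mk (@finrank_euclideanSpace_fin ℝ _ (n + 1))
  exact contMDiff_coe_sphere

/-- The inclusion of `𝕊¹ × 𝕊ⁿ` in `ℂ × ℝ^(n+1)`. -/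
def emb (m : Circle × Sph n) : ℂ × EuclideanSpace ℝ (Fin (n + 1)) := (m.1, m.2)

theorem contMDiff_emb {k : WithTop ℕ∞} :
    ContMDiff ((𝓡 1).prod (𝓡 n)) 𝓘(ℝ, ℂ × EuclideanSpace ℝ (Fin (n + 1))) k (emb (n := n)) := by
  exact (contMDiff_coe_circle.comp contMDiff_fst).prodMk_space (contMDiff_coe_sph.comp contMDiff_snd)

/-- The linear map that sends the velocity of a curve `(exp (i t), w)` in `𝕊¹ × ℝ^(n+1)` to
`t' • gen e l w + w'`, which is the velocity of `dil e (t • l) w` moved back to `w` by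
`dil e (-t • l)`. The angular velocity is written as the imaginary part of `conj z * z'`. -/
def velocity (l : ℝ × ℝ) (p : ℂ × EuclideanSpace ℝ (Fin (n + 1))) :
    ℂ × EuclideanSpace ℝ (Fin (n + 1)) →L[ℝ] EuclideanSpace ℝ (Fin (n + 1)) :=
  ((Complex.imCLM.comp (ContinuousLinearMap.mul ℝ ℂ (Complex.conjCLE p.1))).comp
    (ContinuousLinearMap.fst ℝ _ _)).smulRight (gen e l p.2) + ContinuousLinearMap.snd ℝ _ _

theorem velocity_apply (l : ℝ × ℝ) (p w : ℂ × EuclideanSpace ℝ (Fin (n + 1))) :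
    velocity e l p w = ((starRingEnd ℂ) p.1 * w.1).im • gen e l p.2 + w.2 := rfl

theorem contDiff_velocity : ContDiff ℝ ω
    fun y : (ℝ × ℝ) × (ℂ × EuclideanSpace ℝ (Fin (n + 1))) => velocity e y.1 y.2 := by
  have h : ContDiff ℝ ω
      fun y : (ℝ × ℝ) × (ℂ × EuclideanSpace ℝ (Fin (n + 1))) => gen e y.1 y.2.2 := by
    rw [contDiff_euclidean]
    intro i
    simp only [gen_apply]
    exact ((contDiff_weight e i).comp contDiff_fst).mul (by fun_prop)
  unfold velocity
  refine ContDiff.add (ContDiff.smulRight ?_ h) contDiff_const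
  refine ContDiff.clm_comp (contDiff_const.clm_comp ?_) contDiff_const
  exact (ContinuousLinearMap.mul ℝ ℂ).contDiff.comp
    (Complex.conjCLE.contDiff.comp (contDiff_fst.comp contDiff_snd))

theorem contDiff_const_add_smul {X G : Type*} [NormedAddCommGroup X] [NormedSpace ℝ X]
    [NormedAddCommGroup G] [NormedSpace ℝ G] {k : WithTop ℕ∞} (A B : G) {f : X → ℝ}
    (hf : ContDiff ℝ k f) : ContDiff ℝ k fun x => A + f x • B :=
  contDiff_const.add (hf.smul contDiff_const)

theorem contDiff_metric {k : WithTop ℕ∞} (ε : ℝ) : ContDiff ℝ k (metric e ε) :=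
  contDiff_const_add_smul _ _ (by fun_prop)

/-- The pullback of a bilinear form by a linear map. -/
def pullForm {V W : Type*} [AddCommGroup V] [TopologicalSpace V] [Module ℝ V] [AddCommGroup W]
    [TopologicalSpace W] [Module ℝ W] (B : W →L[ℝ] W →L[ℝ] ℝ) (L : V →L[ℝ] W) : V →L[ℝ] V →L[ℝ] ℝ :=
  (ContinuousLinearMap.precomp ℝ L).comp (B.comp L)

theorem contDiff_pullForm {V W : Type*} [NormedAddCommGroup V] [NormedSpace ℝ V]
    [NormedAddCommGroup W] [NormedSpace ℝ W] {k : WithTop ℕ∞} :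
    ContDiff ℝ k fun q : (W →L[ℝ] W →L[ℝ] ℝ) × (V →L[ℝ] W) => pullForm q.1 q.2 :=
  ((ContinuousLinearMap.compL ℝ V W ℝ).flip.contDiff.comp contDiff_snd).clm_comp
    (contDiff_fst.clm_comp contDiff_snd)

theorem contDiff_pullForm_comp {X V W : Type*} [NormedAddCommGroup X] [NormedSpace ℝ X]
    [NormedAddCommGroup V] [NormedSpace ℝ V] [NormedAddCommGroup W] [NormedSpace ℝ W]
    {k : WithTop ℕ∞} {B : X → W →L[ℝ] W →L[ℝ] ℝ} {L : X → V →L[ℝ] W} (hB : ContDiff ℝ k B)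
    (hL : ContDiff ℝ k L) : ContDiff ℝ k fun x => pullForm (B x) (L x) :=
  contDiff_pullForm.comp (hB.prodMk hL)

/-- A field of bilinear forms on `ℂ × ℝ^(n+1)` that restricts to `field e l` on `𝕊¹ × 𝕊ⁿ`. -/
def ambientForm (l : ℝ × ℝ) (p : ℂ × EuclideanSpace ℝ (Fin (n + 1))) :
    ℂ × EuclideanSpace ℝ (Fin (n + 1)) →L[ℝ] ℂ × EuclideanSpace ℝ (Fin (n + 1)) →L[ℝ] ℝ :=
  pullForm (metric e 1 p.2) (velocity e l p)

theorem contDiff_ambientForm : ContDiff ℝ ω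
    fun y : (ℝ × ℝ) × (ℂ × EuclideanSpace ℝ (Fin (n + 1))) => ambientForm e y.1 y.2 := by
  have h : ContDiff ℝ ω fun y : (ℝ × ℝ) × (ℂ × EuclideanSpace ℝ (Fin (n + 1))) =>
      metric e 1 y.2.2 := (contDiff_metric e 1).comp (contDiff_snd.comp contDiff_snd)
  exact contDiff_pullForm_comp h (contDiff_velocity e)

/-- The map from the tangent spaces of `𝕊¹ × 𝕊ⁿ` to `ℝ^(n+1)` given by `velocity`. It is bijective
if both components of `l` are positive. -/
def frame (l : ℝ × ℝ) (m : Circle × Sph n) :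
    TangentSpace ((𝓡 1).prod (𝓡 n)) m →L[ℝ] EuclideanSpace ℝ (Fin (n + 1)) :=
  (velocity e l (emb m)).comp (mvfderiv ((𝓡 1).prod (𝓡 n)) emb m)

/-- The metric on `𝕊¹ × 𝕊ⁿ` with parameter `l`. It represents the conformal class that the plane
wave without the origin induces on its quotient by the homothety `dil e ((2 * π) • l)`; see
`field_proj`. -/
def field (l : ℝ × ℝ) : PseudoConformal.BilinField ((𝓡 1).prod (𝓡 n)) (Circle × Sph n) :=
  fun m => pullForm (metric e 1 m.2) (frame e l m)

theorem field_apply (l : ℝ × ℝ) (m : Circle × Sph n) (u v : TangentSpace ((𝓡 1).prod (𝓡 n)) m) :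
    field e l m u v = metric e 1 m.2 (frame e l m u) (frame e l m v) := rfl

theorem contMDiffAt_pullForm {X HX N V W : Type*} [NormedAddCommGroup X] [NormedSpace ℝ X]
    [TopologicalSpace HX] {J : ModelWithCorners ℝ X HX} [TopologicalSpace N] [ChartedSpace HX N]
    [NormedAddCommGroup V] [NormedSpace ℝ V] [NormedAddCommGroup W] [NormedSpace ℝ W]
    {k : WithTop ℕ∞} {B : N → W →L[ℝ] W →L[ℝ] ℝ} {L : N → V →L[ℝ] W} {y : N}
    (hB : ContMDiffAt J 𝓘(ℝ, W →L[ℝ] W →L[ℝ] ℝ) k B y)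
    (hL : ContMDiffAt J 𝓘(ℝ, V →L[ℝ] W) k L y) :
    ContMDiffAt J 𝓘(ℝ, V →L[ℝ] V →L[ℝ] ℝ) k (fun x => pullForm (B x) (L x)) y :=
  contDiff_pullForm.contMDiff.contMDiffAt.comp y (hB.prodMk_space hL)

/-- Pulling back an analytic family of bilinear forms on a vector space by the differential of an
analytic vector-valued map yields an analytic section of the bundle of bilinear forms. -/
theorem contMDiff_pullForm_mvfderiv {X HX N V H M W : Type*} [NormedAddCommGroup X]
    [NormedSpace ℝ X] [TopologicalSpace HX] {J : ModelWithCorners ℝ X HX} [TopologicalSpace N]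
    [ChartedSpace HX N] [NormedAddCommGroup V] [NormedSpace ℝ V] [TopologicalSpace H]
    {I : ModelWithCorners ℝ V H} [TopologicalSpace M] [ChartedSpace H M] [IsManifold I 1 M]
    [IsManifold I ω M]
    [NormedAddCommGroup W] [NormedSpace ℝ W] {b : N → M} (hb : ContMDiff J I ω b) {Φ : M → W}
    (hΦ : ContMDiff I 𝓘(ℝ, W) ω Φ) {B : N → W →L[ℝ] W →L[ℝ] ℝ}
    (hB : ContMDiff J 𝓘(ℝ, W →L[ℝ] W →L[ℝ] ℝ) ω B) :
    ContMDiff J (I.prod 𝓘(ℝ, V →L[ℝ] V →L[ℝ] ℝ)) ω (fun y : N =>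
      (TotalSpace.mk' (V →L[ℝ] V →L[ℝ] ℝ) (b y) (pullForm (B y) (mvfderiv I Φ (b y))) :
        TotalSpace (V →L[ℝ] V →L[ℝ] ℝ)
          (fun x : M => TangentSpace I x →L[ℝ] TangentSpace I x →L[ℝ] ℝ))) := by
  intro y₀
  rw [contMDiffAt_hom_bundle]
  refine ⟨hb y₀, ?_⟩
  -- the differential of `Φ`, read in the trivialization at `b y₀`
  let D : M → V →L[ℝ] W := inTangentCoordinates I 𝓘(ℝ, W) id Φ (mfderiv I 𝓘(ℝ, W) Φ) (b y₀)
  have hD : ContMDiffAt I 𝓘(ℝ, V →L[ℝ] W) ω D (b y₀) := (hΦ (b y₀)).mfderiv_const (by simp)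
  have hD' : ContMDiffAt J 𝓘(ℝ, V →L[ℝ] W) ω (fun y => D (b y)) y₀ := hD.comp y₀ (hb y₀)
  refine (contMDiffAt_pullForm (hB y₀) hD').congr_of_eventuallyEq ?_
  have hb' : ∀ᶠ y in 𝓝 y₀, b y ∈ (trivializationAt V (TangentSpace I) (b y₀)).baseSet :=
    (hb y₀).continuousAt.eventually_mem ((trivializationAt _ _ (b y₀)).open_baseSet.mem_nhds
      (FiberBundle.mem_baseSet_trivializationAt' (b y₀)))
  filter_upwards [hb'] with y hy
  have key : ∀ w, D (b y) w = mvfderiv I Φ (b y)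
      ((trivializationAt V (TangentSpace I) (b y₀)).symm (b y) w) := by
    intro w
    change ContinuousLinearMap.inCoordinates V (TangentSpace I) W (TangentSpace 𝓘(ℝ, W)) (b y₀) (b y)
      (Φ (b y₀)) (Φ (b y)) (mfderiv I 𝓘(ℝ, W) Φ (b y)) w = _
    have hmem : Φ (b y) ∈ (trivializationAt W (TangentSpace 𝓘(ℝ, W)) (Φ (b y₀))).baseSet :=
      mem_univ _
    rw [ContinuousLinearMap.inCoordinates_eq hy hmem]
    change (Trivialization.continuousLinearEquivAt ℝ (trivializationAt W (TangentSpace 𝓘(ℝ, W))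
      (Φ (b y₀))) (Φ (b y)) hmem) _ = _
    rw [Trivialization.coe_continuousLinearEquivAt_eq]
    exact congrArg (fun L : W →L[ℝ] W => L _)
      (TangentBundle.continuousLinearMapAt_model_space (Φ (b y₀)) (Φ (b y)))
  ext u v
  rw [inCoordinates_apply_eq₂ hy hy (by simp)]
  change _ = B y (D (b y) u) (D (b y) v)
  rw [key, key]
  simp
  rfl

theorem contMDiff_pullForm_parameter {P V H M W : Type*} [NormedAddCommGroup P]
    [NormedSpace ℝ P] [NormedAddCommGroup V] [NormedSpace ℝ V] [TopologicalSpace H]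
    {I : ModelWithCorners ℝ V H} [TopologicalSpace M] [ChartedSpace H M] [IsManifold I 1 M]
    [IsManifold I ω M]
    [NormedAddCommGroup W] [NormedSpace ℝ W] {Φ : M → W}
    (hΦ : ContMDiff I 𝓘(ℝ, W) ω Φ) {B : P → W → W →L[ℝ] W →L[ℝ] ℝ}
    (hB : ContDiff ℝ ω fun q : P × W => B q.1 q.2) :
    ContMDiff (𝓘(ℝ, P).prod I) (I.prod 𝓘(ℝ, V →L[ℝ] V →L[ℝ] ℝ)) ω (fun y : P × M =>
      (TotalSpace.mk' (V →L[ℝ] V →L[ℝ] ℝ) y.2 (pullForm (B y.1 (Φ y.2)) (mvfderiv I Φ y.2)) :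
        TotalSpace (V →L[ℝ] V →L[ℝ] ℝ)
          (fun x : M => TangentSpace I x →L[ℝ] TangentSpace I x →L[ℝ] ℝ))) := by
  have h1 : ContMDiff (𝓘(ℝ, P).prod I) 𝓘(ℝ, P) ω (fun y : P × M => y.1) := contMDiff_fst
  exact contMDiff_pullForm_mvfderiv contMDiff_snd hΦ
    (hB.contMDiff.comp (h1.prodMk_space (hΦ.comp contMDiff_snd)))

theorem contMDiff_field : ContMDiff (𝓘(ℝ, ℝ × ℝ).prod ((𝓡 1).prod (𝓡 n)))
    (((𝓡 1).prod (𝓡 n)).prod 𝓘(ℝ, (EuclideanSpace ℝ (Fin 1) × EuclideanSpace ℝ (Fin n)) →L[ℝ]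
      (EuclideanSpace ℝ (Fin 1) × EuclideanSpace ℝ (Fin n)) →L[ℝ] ℝ)) ω
    (fun y : (ℝ × ℝ) × (Circle × Sph n) =>
      (TotalSpace.mk' ((EuclideanSpace ℝ (Fin 1) × EuclideanSpace ℝ (Fin n)) →L[ℝ]
      (EuclideanSpace ℝ (Fin 1) × EuclideanSpace ℝ (Fin n)) →L[ℝ] ℝ) y.2 (field e y.1 y.2) :
      TotalSpace ((EuclideanSpace ℝ (Fin 1) × EuclideanSpace ℝ (Fin n)) →L[ℝ]
      (EuclideanSpace ℝ (Fin 1) × EuclideanSpace ℝ (Fin n)) →L[ℝ] ℝ)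
        (fun x : Circle × Sph n => TangentSpace ((𝓡 1).prod (𝓡 n)) x →L[ℝ]
          TangentSpace ((𝓡 1).prod (𝓡 n)) x →L[ℝ] ℝ))) := by
  exact contMDiff_pullForm_parameter contMDiff_emb (contDiff_ambientForm e)

end

/-! ### The differential of the embedding, and maps into the sphere -/

section

section ChainRules

variable {X HX N V H M W G : Type*} [NormedAddCommGroup X] [NormedSpace ℝ X] [TopologicalSpace HX]
  {J : ModelWithCorners ℝ X HX} [TopologicalSpace N] [ChartedSpace HX N] [NormedAddCommGroup V]
  [NormedSpace ℝ V] [TopologicalSpace H] {I : ModelWithCorners ℝ V H} [TopologicalSpace M]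
  [ChartedSpace H M] [NormedAddCommGroup W] [NormedSpace ℝ W] [NormedAddCommGroup G]
  [NormedSpace ℝ G]

theorem mvfderiv_comp_mfderiv {Φ : M → W} {f : N → M} {x : N}
    (hΦ : MDifferentiableAt I 𝓘(ℝ, W) Φ (f x)) (hf : MDifferentiableAt J I f x)
    (u : TangentSpace J x) :
    mvfderiv J (fun y => Φ (f y)) x u = mvfderiv I Φ (f x) (mfderiv J I f x u) :=
  mfderiv_comp_apply x hΦ hf u

theorem mvfderiv_comp_fderiv {Φ : W → G} {f : N → W} {x : N} (hΦ : DifferentiableAt ℝ Φ (f x))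
    (hf : MDifferentiableAt J 𝓘(ℝ, W) f x) (u : TangentSpace J x) :
    mvfderiv J (fun y => Φ (f y)) x u = fderiv ℝ Φ (f x) (mvfderiv J f x u) := by
  have h := mfderiv_comp_apply x hΦ.mdifferentiableAt hf u
  rw [mfderiv_eq_fderiv] at h
  exact h

theorem mvfderiv_eq_fderiv (Φ : W → G) (x : W) (u : W) :
    mvfderiv 𝓘(ℝ, W) Φ x u = fderiv ℝ Φ x u :=
  congrArg (fun L : W →L[ℝ] G => L u) (mfderiv_eq_fderiv (𝕜 := ℝ) (f := Φ) (x := x))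

end ChainRules

variable {n r s : ℕ} (e : Fin 4 ⊕ (Fin r ⊕ Fin s) ≃ Fin (n + 1))

theorem mdifferentiable_emb :
    MDifferentiable ((𝓡 1).prod (𝓡 n)) 𝓘(ℝ, ℂ × EuclideanSpace ℝ (Fin (n + 1))) (emb (n := n)) :=
  (contMDiff_emb (k := 1)).mdifferentiable one_ne_zero

theorem fst_mvfderiv_emb (m : Circle × Sph n) (u : TangentSpace ((𝓡 1).prod (𝓡 n)) m) :
    (mvfderiv ((𝓡 1).prod (𝓡 n)) emb m u).1 =
      mvfderiv (𝓡 1) (fun z : Circle => (z : ℂ)) m.1 u.1 := by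
  have h1 := mvfderiv_comp_fderiv (Φ := (Prod.fst : ℂ × EuclideanSpace ℝ (Fin (n + 1)) → ℂ))
    (f := emb (n := n)) (x := m) differentiableAt_fst (mdifferentiable_emb m) u
  have h2 := mvfderiv_comp_mfderiv (I := 𝓡 1) (J := (𝓡 1).prod (𝓡 n))
    (Φ := fun z : Circle => (z : ℂ)) (f := (Prod.fst : Circle × Sph n → Circle)) (x := m)
    ((contMDiff_coe_circle (k := 1)).mdifferentiable one_ne_zero m.1) mdifferentiableAt_fst u
  rw [fderiv_fst] at h1
  rw [mfderiv_fst] at h2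
  exact h1.symm.trans h2

theorem snd_mvfderiv_emb (m : Circle × Sph n) (u : TangentSpace ((𝓡 1).prod (𝓡 n)) m) :
    (mvfderiv ((𝓡 1).prod (𝓡 n)) emb m u).2 =
      mvfderiv (𝓡 n) (fun w : Sph n => (w : EuclideanSpace ℝ (Fin (n + 1)))) m.2 u.2 := by
  have h1 := mvfderiv_comp_fderiv (Φ := (Prod.snd : ℂ × EuclideanSpace ℝ (Fin (n + 1)) → _))
    (f := emb (n := n)) (x := m) differentiableAt_snd (mdifferentiable_emb m) u
  have h2 := mvfderiv_comp_mfderiv (I := 𝓡 n) (J := (𝓡 1).prod (𝓡 n))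
    (Φ := fun w : Sph n => (w : EuclideanSpace ℝ (Fin (n + 1))))
    (f := (Prod.snd : Circle × Sph n → Sph n)) (x := m)
    ((contMDiff_coe_sph (k := 1)).mdifferentiable one_ne_zero m.2) mdifferentiableAt_snd u
  rw [fderiv_snd] at h1
  rw [mfderiv_snd] at h2
  exact h1.symm.trans h2

theorem norm_coe_sph (w : Sph n) : ‖(w : EuclideanSpace ℝ (Fin (n + 1)))‖ = 1 := by
  simp

theorem coe_sph_ne_zero (w : Sph n) : (w : EuclideanSpace ℝ (Fin (n + 1))) ≠ 0 := by
  intro h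
  simpa [h] using norm_coe_sph w

theorem inner_gen_pos {l : ℝ × ℝ} (hl : 0 < l.1 ∧ 0 < l.2) {x : EuclideanSpace ℝ (Fin (n + 1))}
    (hx : x ≠ 0) : 0 < inner ℝ x (gen e l x) := by
  obtain ⟨i, hi⟩ := exists_apply_ne_zero hx
  simp only [PiLp.inner_apply, gen_apply]
  refine Finset.sum_pos' (fun j _ => ?_) ⟨i, Finset.mem_univ _, ?_⟩
  · have := weight_pos e hl.1 hl.2 j
    have : 0 ≤ weight e l j * (x j * x j) := mul_nonneg this.le (mul_self_nonneg _)
    simpa [mul_assoc] using this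
  · have := weight_pos e hl.1 hl.2 i
    have h : 0 < weight e l i * (x i * x i) := mul_pos this (mul_self_pos.2 hi)
    simpa [mul_assoc] using h

theorem injective_mvfderiv_coe_circle (z : Circle) :
    Function.Injective (mvfderiv (𝓡 1) (fun z : Circle => (z : ℂ)) z) := by
  have := finrank_real_complex_fact'
  exact injective_mvfderiv_subtypeVal_sphere (n := 1) (E := ℂ) z

theorem injective_mvfderiv_coe_sph (w : Sph n) :
    Function.Injective (mvfderiv (𝓡 n) (fun w : Sph n => (w : EuclideanSpace ℝ (Fin (n + 1)))) w) := by
  have := Fact.mk (@finrank_euclideanSpace_fin ℝ _ (n + 1))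
  exact injective_mvfderiv_subtypeVal_sphere (n := n) w

theorem eq_zero_of_inner_eq_zero {z w : ℂ} (hz : z ≠ 0) (h : inner ℝ z w = 0)
    (h' : ((starRingEnd ℂ) z * w).im = 0) : w = 0 := by
  rw [Complex.inner, mul_comm] at h
  rw [mul_comm] at h'
  have h6 : w * (starRingEnd ℂ) z = 0 := Complex.ext (by simpa [mul_comm] using h) h'
  exact (mul_eq_zero.1 h6).resolve_right (by simpa using hz)

/-- The vector `gen e l w` is transverse to the sphere at `w`, and the other tangent directions are
orthogonal to `w`. -/
theorem frame_injective {l : ℝ × ℝ} (hl : 0 < l.1 ∧ 0 < l.2) (m : Circle × Sph n) :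
    Function.Injective (frame e l m) := by
  have := Fact.mk (@finrank_euclideanSpace_fin ℝ _ (n + 1))
  have := finrank_real_complex_fact'
  rw [injective_iff_map_eq_zero]
  intro u hu
  set w := mvfderiv ((𝓡 1).prod (𝓡 n)) emb m u with hw
  have h0 : ((starRingEnd ℂ) (m.1 : ℂ) * w.1).im • gen e l m.2 + w.2 = 0 := hu
  have h1 : inner ℝ (m.1 : ℂ) w.1 = 0 := by
    have : w.1 ∈ (ℝ ∙ (m.1 : ℂ))ᗮ := by
      rw [← range_mvfderiv_subtypeVal (n := 1) (E := ℂ) m.1, hw, fst_mvfderiv_emb]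
      exact ⟨u.1, rfl⟩
    exact Submodule.mem_orthogonal_singleton_iff_inner_right.1 this
  have h2 : inner ℝ (m.2 : EuclideanSpace ℝ (Fin (n + 1))) w.2 = 0 := by
    have : w.2 ∈ (ℝ ∙ (m.2 : EuclideanSpace ℝ (Fin (n + 1))))ᗮ := by
      rw [← range_mvfderiv_subtypeVal (n := n) m.2, hw, snd_mvfderiv_emb]
      exact ⟨u.2, rfl⟩
    exact Submodule.mem_orthogonal_singleton_iff_inner_right.1 this
  have h3 : ((starRingEnd ℂ) (m.1 : ℂ) * w.1).im = 0 := by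
    have h := congrArg (fun y => inner ℝ (m.2 : EuclideanSpace ℝ (Fin (n + 1))) y) h0
    simp only [inner_add_right, inner_smul_right, h2, inner_zero_right, add_zero] at h
    exact (mul_eq_zero.1 h).resolve_right (inner_gen_pos e hl (coe_sph_ne_zero m.2)).ne'
  have h4 : w.2 = 0 := by simpa [h3] using h0
  have h5 : w.1 = 0 := eq_zero_of_inner_eq_zero (by simp) h1 h3
  rw [hw, fst_mvfderiv_emb] at h5
  rw [hw, snd_mvfderiv_emb] at h4
  refine Prod.ext ?_ ?_
  · exact (injective_iff_map_eq_zero _).1 (injective_mvfderiv_coe_circle m.1) _ h5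
  · exact (injective_iff_map_eq_zero _).1 (injective_mvfderiv_coe_sph m.2) _ h4

/-- A vector of norm one as a point of the unit sphere; other vectors are sent to a base point. -/
def toSph (x : EuclideanSpace ℝ (Fin (n + 1))) : Sph n :=
  if h : ‖x‖ = 1 then ⟨x, by simpa using h⟩ else ⟨EuclideanSpace.single 0 1, by simp⟩

theorem coe_toSph {x : EuclideanSpace ℝ (Fin (n + 1))} (h : ‖x‖ = 1) :
    (toSph x : EuclideanSpace ℝ (Fin (n + 1))) = x := by
  rw [toSph, dif_pos h]

theorem contMDiffAt_toSph {X HX N : Type*} [NormedAddCommGroup X] [NormedSpace ℝ X]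
    [TopologicalSpace HX] {J : ModelWithCorners ℝ X HX} [TopologicalSpace N] [ChartedSpace HX N]
    {k : WithTop ℕ∞} [IsManifold J k N] {f : N → EuclideanSpace ℝ (Fin (n + 1))} {y : N}
    (hf : ContMDiffAt J 𝓘(ℝ, EuclideanSpace ℝ (Fin (n + 1))) k f y)
    (h : ∀ᶠ x in 𝓝 y, ‖f x‖ = 1) : ContMDiffAt J (𝓡 n) k (fun x => toSph (f x)) y := by
  have := Fact.mk (@finrank_euclideanSpace_fin ℝ _ (n + 1))
  rw [contMDiffAt_iff_target]
  refine ⟨?_, ?_⟩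
  · refine Topology.IsInducing.subtypeVal.continuousAt_iff.2 ?_
    refine hf.continuousAt.congr (h.mono fun x hx => (coe_toSph hx).symm)
  · set v : Sph n := toSph (f y)
    let U := (OrthonormalBasis.fromOrthogonalSpanSingleton (𝕜 := ℝ)
        n (ne_zero_of_mem_unit_sphere (-v))).repr
    have h1 : ContDiffOn ℝ ω _ Set.univ := U.contDiff.contDiffOn
    have H₁ := (h1.comp_inter contDiffOn_stereoToFun).contMDiffOn
    have hmem : f y ∈ {x | innerSL ℝ ((-v : Sph n) : EuclideanSpace ℝ (Fin (n + 1))) x ≠ (1 : ℝ)} ∩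
        stereoToFun ((-v : Sph n) : EuclideanSpace ℝ (Fin (n + 1))) ⁻¹' univ := by
      refine ⟨?_, mem_univ _⟩
      have hv : (v : EuclideanSpace ℝ (Fin (n + 1))) = f y := coe_toSph h.self_of_nhds
      simp [hv, h.self_of_nhds]
      norm_num
    have hopen : IsOpen ({x | innerSL ℝ ((-v : Sph n) : EuclideanSpace ℝ (Fin (n + 1))) x ≠ (1 : ℝ)} ∩
        stereoToFun ((-v : Sph n) : EuclideanSpace ℝ (Fin (n + 1))) ⁻¹' univ) := by
      rw [preimage_univ, inter_univ]
      exact isOpen_ne_fun (by fun_prop) (by fun_prop)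
    have H₂ := ((H₁.of_le (le_top (a := k))).contMDiffAt (hopen.mem_nhds hmem)).comp y hf
    refine H₂.congr_of_eventuallyEq ?_
    filter_upwards [h] with x hx
    change U (stereoToFun _ (toSph (f x) : EuclideanSpace ℝ (Fin (n + 1)))) = _
    rw [coe_toSph hx]
    rfl

end

/-! ### Signature, and the projection from the plane wave -/

section

section StandardForm

variable {ι : Type*} [Fintype ι] [DecidableEq ι] {r s : ℕ} (e : Fin 4 ⊕ (Fin r ⊕ Fin s) ≃ ι)

/-- Coordinates in which `form` becomes the standard form: a hyperbolic plane `2 dx dy` is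
`(dx / 2 + dy)² - (dx / 2 - dy)²`. -/
def stdCoords : EuclideanSpace ℝ ι →ₗ[ℝ] (Fin (r + 2) ⊕ Fin (s + 2) → ℝ) where
  toFun u := Sum.elim
    (Fin.cons (coord e 0 u / 2 - coord e 2 u) (Fin.cons (coord e 1 u / 2 - coord e 3 u)
      fun i => u (e (.inr (.inl i)))))
    (Fin.cons (coord e 0 u / 2 + coord e 2 u) (Fin.cons (coord e 1 u / 2 + coord e 3 u)
      fun i => u (e (.inr (.inr i)))))
  map_add' u v := by
    ext (i | i) <;> refine Fin.cases ?_ (fun i => Fin.cases ?_ (fun i => ?_) i) i <;>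
      simp <;> ring
  map_smul' c u := by
    ext (i | i) <;> refine Fin.cases ?_ (fun i => Fin.cases ?_ (fun i => ?_) i) i <;>
      simp <;> ring

theorem stdForm_stdCoords (u v : EuclideanSpace ℝ ι) :
    PseudoConformal.stdForm (r + 2) (s + 2) (stdCoords e u) (stdCoords e v) = form e u v := by
  rw [form_apply, ← e.sum_comp, Fintype.sum_sum_type, Fintype.sum_sum_type]
  simp only [PseudoConformal.stdForm, stdCoords, Fin.sum_univ_succ (n := r + 1),
    Fin.sum_univ_succ (n := s + 1), Fin.sum_univ_succ (n := r), Fin.sum_univ_succ (n := s),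
    LinearMap.coe_mk, AddHom.coe_mk, Sum.elim_inl, Sum.elim_inr, Fin.cons_zero, Fin.cons_succ,
    sgn, Equiv.symm_apply_apply]
  simp only [zero_mul, Finset.sum_const_zero, neg_one_mul, Finset.sum_neg_distrib, one_mul]
  ring

theorem stdCoords_injective : Function.Injective (stdCoords e) := by
  rw [injective_iff_map_eq_zero]
  intro u hu
  refine eq_zero_of_form e fun v => ?_
  rw [← stdForm_stdCoords, hu]
  simp [PseudoConformal.stdForm]

theorem card_eq (e : Fin 4 ⊕ (Fin r ⊕ Fin s) ≃ ι) : Fintype.card ι = r + s + 4 := by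
  rw [← Fintype.card_congr e]
  simp
  ring

/-- `stdCoords` as a linear equivalence. -/
def stdEquiv : EuclideanSpace ℝ ι ≃ₗ[ℝ] (Fin (r + 2) ⊕ Fin (s + 2) → ℝ) :=
  LinearEquiv.ofInjectiveOfFinrankEq (stdCoords e) (stdCoords_injective e) (by
    simp [card_eq e]; omega)

theorem stdForm_stdEquiv (u v : EuclideanSpace ℝ ι) :
    PseudoConformal.stdForm (r + 2) (s + 2) (stdEquiv e u) (stdEquiv e v) = form e u v :=
  stdForm_stdCoords e u v

/-- The shear that carries the metric of the plane wave at `x` to `form`. -/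
def shear (x : EuclideanSpace ℝ ι) : EuclideanSpace ℝ ι →ₗ[ℝ] EuclideanSpace ℝ ι :=
  LinearMap.id + ((coord e 3 x ^ 2 / 2) • (coord e 2).toLinearMap).smulRight (vec e 0)

theorem form_shear (x u v : EuclideanSpace ℝ ι) :
    form e (shear e x u) (shear e x v) = metric e 1 x u v := by
  have h0 : ∀ w, form e (vec e 0) w = coord e 2 w := fun w => by
    rw [form_comm, form_vec]; rfl
  have h1 : ∀ w, form e w (vec e 0) = coord e 2 w := fun w => by rw [form_vec]; rfl
  have h2 : coord e 2 (vec e 0) = 0 := by rw [coord_vec]; rfl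
  simp only [shear, LinearMap.add_apply, LinearMap.id_apply, LinearMap.smulRight_apply,
    LinearMap.smul_apply, ContinuousLinearMap.coe_coe, map_add, map_smul, smul_eq_mul,
    add_apply, smul_apply, h0, h1, h2, metric_apply]
  ring

theorem shear_injective (x : EuclideanSpace ℝ ι) : Function.Injective (shear e x) := by
  rw [injective_iff_map_eq_zero]
  intro u hu
  have h2 : coord e 2 (vec e 0) = 0 := by rw [coord_vec]; rfl
  have h3 : coord e 2 u = 0 := by
    have := congrArg (coord e 2) hu
    simpa [shear, h2] using this
  simpa [shear, h3] using hu

end StandardForm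

variable {n r s : ℕ} (e : Fin 4 ⊕ (Fin r ⊕ Fin s) ≃ Fin (n + 1)) {l : ℝ × ℝ}

set_option synthInstance.maxHeartbeats 400000 in
theorem contMDiff_pullForm_id {V H M W : Type*} [NormedAddCommGroup V] [NormedSpace ℝ V]
    [TopologicalSpace H] {I : ModelWithCorners ℝ V H} [TopologicalSpace M] [ChartedSpace H M]
    [IsManifold I 1 M] [IsManifold I ω M] [NormedAddCommGroup W] [NormedSpace ℝ W] {Φ : M → W}
    (hΦ : ContMDiff I 𝓘(ℝ, W) ω Φ) {B : W → W →L[ℝ] W →L[ℝ] ℝ} (hB : ContDiff ℝ ω B) :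
    ContMDiff I (I.prod 𝓘(ℝ, V →L[ℝ] V →L[ℝ] ℝ)) ω (fun x : M =>
      (TotalSpace.mk' (V →L[ℝ] V →L[ℝ] ℝ) x (pullForm (B (Φ x)) (mvfderiv I Φ x)) :
        TotalSpace (V →L[ℝ] V →L[ℝ] ℝ)
          (fun x : M => TangentSpace I x →L[ℝ] TangentSpace I x →L[ℝ] ℝ))) :=
  contMDiff_pullForm_mvfderiv contMDiff_id hΦ (hB.contMDiff.comp hΦ)

theorem exists_stdForm_field (hl : 0 < l.1 ∧ 0 < l.2) (m : Circle × Sph n) :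
    ∃ L : TangentSpace ((𝓡 1).prod (𝓡 n)) m ≃ₗ[ℝ] (Fin (r + 2) ⊕ Fin (s + 2) → ℝ),
      ∀ u v : TangentSpace ((𝓡 1).prod (𝓡 n)) m,
        field e l m u v = PseudoConformal.stdForm (r + 2) (s + 2) (L u) (L v) := by
  let A : TangentSpace ((𝓡 1).prod (𝓡 n)) m →ₗ[ℝ] (Fin (r + 2) ⊕ Fin (s + 2) → ℝ) :=
    ((stdEquiv e).toLinearMap ∘ₗ shear e m.2) ∘ₗ (frame e l m).toLinearMap
  have hA : Function.Injective A :=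
    ((stdEquiv e).injective.comp (shear_injective e m.2)).comp (frame_injective e hl m)
  have hrank : Module.finrank ℝ (EuclideanSpace ℝ (Fin 1) × EuclideanSpace ℝ (Fin n)) =
      Module.finrank ℝ (Fin (r + 2) ⊕ Fin (s + 2) → ℝ) := by
    have := card_eq e
    simp at this
    simp
    omega
  have : FiniteDimensional ℝ (TangentSpace ((𝓡 1).prod (𝓡 n)) m) :=
    inferInstanceAs (FiniteDimensional ℝ (EuclideanSpace ℝ (Fin 1) × EuclideanSpace ℝ (Fin n)))
  refine ⟨LinearEquiv.ofInjectiveOfFinrankEq A hA hrank, fun u v => ?_⟩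
  have h : ∀ u, LinearEquiv.ofInjectiveOfFinrankEq A hA hrank u =
    stdEquiv e (shear e m.2 (frame e l m u)) := fun u => rfl
  rw [h, h, stdForm_stdEquiv, field_apply]
  exact (form_shear e _ _ _).symm

set_option synthInstance.maxHeartbeats 400000 in
theorem isPseudoRiemannianMetric_field (hl : 0 < l.1 ∧ 0 < l.2) :
    PseudoConformal.IsPseudoRiemannianMetric ((𝓡 1).prod (𝓡 n)) ω (r + 2) (s + 2) (field e l) :=
  ⟨contMDiff_pullForm_id contMDiff_emb
    ((contDiff_ambientForm e).comp (contDiff_const.prodMk contDiff_id)), exists_stdForm_field e hl⟩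

theorem isAnalyticFamilyOn_field (Λ : Set (ℝ × ℝ)) :
    PseudoConformal.IsAnalyticFamilyOn ((𝓡 1).prod (𝓡 n)) Λ (field e) :=
  (contMDiff_field e).contMDiffOn

section Polar

variable {X : Type*} [NormedAddCommGroup X] [NormedSpace ℝ X]

theorem hasFDerivAt_circleExp {t : X → ℝ} {t' : X →L[ℝ] ℝ} {x : X} (ht : HasFDerivAt t t' x) :
    HasFDerivAt (fun y => (Circle.exp (t y) : ℂ))
      (t'.smulRight ((Circle.exp (t x) : ℂ) * Complex.I)) x := by
  have h : HasDerivAt (fun a : ℝ => (Circle.exp a : ℂ)) ((Circle.exp (t x) : ℂ) * Complex.I) (t x) := by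
    simp only [Circle.coe_exp]
    have := ((hasDerivAt_id (t x)).ofReal_comp.mul_const Complex.I).cexp
    simpa using this
  refine (h.hasFDerivAt.comp x ht).congr_fderiv ?_
  ext u
  simp

/-- In the polar coordinates `(t, w) ↦ dil e (t • l) w`, the map `velocity` is the differential up
to `dil e (-t • l)`. -/
theorem velocity_polar {t : X → ℝ} {w : X → EuclideanSpace ℝ (Fin (n + 1))} {x : X}
    (ht : DifferentiableAt ℝ t x) (hw : DifferentiableAt ℝ w x) (l : ℝ × ℝ) (u : X) :
    velocity e l (Circle.exp (t x), w x)
      (fderiv ℝ (fun y => ((Circle.exp (t y) : ℂ), w y)) x u) =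
      dil e (-t x • l) (fderiv ℝ (fun y => dil e (t y • l) (w y)) x u) := by
  rw [((hasFDerivAt_circleExp ht.hasFDerivAt).prodMk hw.hasFDerivAt).fderiv,
    (hasFDerivAt_dil_smul e ht.hasFDerivAt hw.hasFDerivAt l).fderiv, velocity_apply]
  simp only [ContinuousLinearMap.prod_apply, ContinuousLinearMap.smulRight_apply,
    ContinuousLinearMap.comp_apply, add_apply]
  rw [← dil_add, neg_smul, neg_add_cancel, dil_zero]
  have h : (starRingEnd ℂ) (Circle.exp (t x) : ℂ) * (Circle.exp (t x) : ℂ) = 1 := by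
    rw [← Complex.normSq_eq_conj_mul_self, Circle.normSq_coe, Complex.ofReal_one]
  have h' : ((starRingEnd ℂ) (Circle.exp (t x) : ℂ) *
      (fderiv ℝ t x u • ((Circle.exp (t x) : ℂ) * Complex.I))).im = fderiv ℝ t x u := by
    rw [Complex.real_smul, show ∀ a b c d : ℂ, a * (b * (c * d)) = b * ((a * c) * d) by intros; ring, h]
    simp
  rw [h']

theorem frame_mfderiv {α : X → Circle × Sph n} {x : X}
    (hα : MDifferentiableAt 𝓘(ℝ, X) ((𝓡 1).prod (𝓡 n)) α x) (l : ℝ × ℝ) (u : X) :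
    frame e l (α x) (mfderiv 𝓘(ℝ, X) ((𝓡 1).prod (𝓡 n)) α x u) =
      velocity e l (emb (α x)) (fderiv ℝ (fun y => emb (α y)) x u) := by
  rw [← mvfderiv_eq_fderiv]
  exact congrArg (velocity e l (emb (α x)))
    (mvfderiv_comp_mfderiv (mdifferentiable_emb (α x)) hα u).symm

theorem frame_polar {α : X → Circle × Sph n} {x : X}
    (hα : MDifferentiableAt 𝓘(ℝ, X) ((𝓡 1).prod (𝓡 n)) α x) {t : X → ℝ}
    {w : X → EuclideanSpace ℝ (Fin (n + 1))} (ht : DifferentiableAt ℝ t x)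
    (hw : DifferentiableAt ℝ w x)
    (h : (fun y => emb (α y)) =ᶠ[𝓝 x] fun y => ((Circle.exp (t y) : ℂ), w y)) (u : X) :
    frame e l (α x) (mfderiv 𝓘(ℝ, X) ((𝓡 1).prod (𝓡 n)) α x u) =
      dil e (-t x • l) (fderiv ℝ (fun y => dil e (t y • l) (w y)) x u) := by
  rw [frame_mfderiv e hα, h.fderiv_eq, show emb (α x) = _ from h.self_of_nhds,
    velocity_polar e ht hw]

end Polar

/-- The projection of the plane wave without the origin onto `𝕊¹ × 𝕊ⁿ`, that is its quotient by the
homothety `dil e ((2 * π) • l)`. -/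
def proj (l : ℝ × ℝ) (x : EuclideanSpace ℝ (Fin (n + 1))) : Circle × Sph n :=
  (Circle.exp (time e l x), toSph (unitPoint e l x))

theorem emb_proj (hl : 0 < l.1 ∧ 0 < l.2) {x : EuclideanSpace ℝ (Fin (n + 1))} (hx : x ≠ 0) :
    emb (proj e l x) = ((Circle.exp (time e l x) : ℂ), unitPoint e l x) :=
  Prod.ext rfl (coe_toSph (norm_unitPoint e hl hx))

theorem contMDiffAt_proj (hl : 0 < l.1 ∧ 0 < l.2) {x : EuclideanSpace ℝ (Fin (n + 1))} (hx : x ≠ 0) :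
    ContMDiffAt 𝓘(ℝ, EuclideanSpace ℝ (Fin (n + 1))) ((𝓡 1).prod (𝓡 n)) ∞ (proj e l) x := by
  refine ContMDiffAt.prodMk ?_ ?_
  · exact contMDiff_circleExp.contMDiffAt.comp x (contDiffAt_time e hl hx).contMDiffAt
  · refine contMDiffAt_toSph (contDiffAt_unitPoint e hl hx).contMDiffAt ?_
    filter_upwards [isOpen_ne.mem_nhds hx] with y hy using norm_unitPoint e hl hy

theorem frame_proj (hl : 0 < l.1 ∧ 0 < l.2) {x : EuclideanSpace ℝ (Fin (n + 1))} (hx : x ≠ 0)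
    (u : EuclideanSpace ℝ (Fin (n + 1))) :
    frame e l (proj e l x) (mfderiv 𝓘(ℝ, EuclideanSpace ℝ (Fin (n + 1))) ((𝓡 1).prod (𝓡 n))
      (proj e l) x u) = dil e (-time e l x • l) u := by
  have h1 : (fun y => emb (proj e l y)) =ᶠ[𝓝 x]
      fun y => ((Circle.exp (time e l y) : ℂ), unitPoint e l y) := by
    filter_upwards [isOpen_ne.mem_nhds hx] with y hy using emb_proj e hl hy
  rw [frame_polar e ((contMDiffAt_proj e hl hx).mdifferentiableAt (by simp))
    ((contDiffAt_time e hl hx).differentiableAt (by simp))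
    ((contDiffAt_unitPoint e hl hx).differentiableAt (by simp)) h1]
  simp only [dil_unitPoint, fderiv_fun_id, ContinuousLinearMap.id_apply]

/-- `proj` is conformal. -/
theorem field_proj (hl : 0 < l.1 ∧ 0 < l.2) {x : EuclideanSpace ℝ (Fin (n + 1))} (hx : x ≠ 0)
    (u v : EuclideanSpace ℝ (Fin (n + 1))) :
    field e l (proj e l x)
      (mfderiv 𝓘(ℝ, EuclideanSpace ℝ (Fin (n + 1))) ((𝓡 1).prod (𝓡 n)) (proj e l) x u)
      (mfderiv 𝓘(ℝ, EuclideanSpace ℝ (Fin (n + 1))) ((𝓡 1).prod (𝓡 n)) (proj e l) x v) =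
      Real.exp (2 * (-time e l x * (l.1 + l.2))) * metric e 1 x u v := by
  rw [field_apply, frame_proj e hl hx, frame_proj e hl hx,
    show ((proj e l x).2 : EuclideanSpace ℝ (Fin (n + 1))) = dil e (-time e l x • l) x from
      coe_toSph (norm_unitPoint e hl hx), metric_dil]
  congr 3
  simp
  ring

end

/-! ### The induced conformal flow and essentiality -/

section

variable {n r s : ℕ} (e : Fin 4 ⊕ (Fin r ⊕ Fin s) ≃ Fin (n + 1)) {l : ℝ × ℝ}

/-- The map of `ℂ × ℝ^(n+1)` that restricts to `flow e l b` on `𝕊¹ × 𝕊ⁿ`. -/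
def ambientFlow (l b : ℝ × ℝ) (p : ℂ × EuclideanSpace ℝ (Fin (n + 1))) :
    ℂ × EuclideanSpace ℝ (Fin (n + 1)) :=
  (p.1 * Circle.exp (time e l (dil e b p.2)), unitPoint e l (dil e b p.2))

theorem hasFDerivAt_comp_dil {G : Type*} [NormedAddCommGroup G] [NormedSpace ℝ G]
    {f : EuclideanSpace ℝ (Fin (n + 1)) → G} {b : ℝ × ℝ} {p : ℂ × EuclideanSpace ℝ (Fin (n + 1))}
    (hf : DifferentiableAt ℝ f (dil e b p.2)) :
    HasFDerivAt (fun q : ℂ × EuclideanSpace ℝ (Fin (n + 1)) => f (dil e b q.2))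
      (((fderiv ℝ f (dil e b p.2)).comp (dil e b)).comp (ContinuousLinearMap.snd ℝ _ _)) p :=
  (hf.hasFDerivAt.comp p.2 (dil e b).hasFDerivAt).comp p hasFDerivAt_snd

theorem hasFDerivAt_ambientFlow (hl : 0 < l.1 ∧ 0 < l.2) (b : ℝ × ℝ)
    {p : ℂ × EuclideanSpace ℝ (Fin (n + 1))} (hp : p.2 ≠ 0) :
    ∃ D : ℂ × EuclideanSpace ℝ (Fin (n + 1)) →L[ℝ] ℂ × EuclideanSpace ℝ (Fin (n + 1)),
      HasFDerivAt (ambientFlow e l b) D p ∧ ∀ w, D w =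
      ((w.1 + (fderiv ℝ (time e l) (dil e b p.2) (dil e b w.2)) • (p.1 * Complex.I)) *
        (Circle.exp (time e l (dil e b p.2)) : ℂ),
        fderiv ℝ (unitPoint e l) (dil e b p.2) (dil e b w.2)) := by
  have h0 := dil_ne_zero e b hp
  have h1 := hasFDerivAt_comp_dil e ((contDiffAt_time e hl h0).differentiableAt (by simp))
  have h2 := hasFDerivAt_comp_dil e ((contDiffAt_unitPoint e hl h0).differentiableAt (by simp))
  have h3 : HasFDerivAt (fun q : ℂ × EuclideanSpace ℝ (Fin (n + 1)) => q.1)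
    (ContinuousLinearMap.fst ℝ _ _) p := hasFDerivAt_fst
  refine ⟨_, (h3.mul (hasFDerivAt_circleExp h1)).prodMk h2, fun w => ?_⟩
  refine Prod.ext ?_ ?_
  · simp
    ring
  · simp

theorem velocity_ambientFlow (hl : 0 < l.1 ∧ 0 < l.2) (b : ℝ × ℝ)
    {p : ℂ × EuclideanSpace ℝ (Fin (n + 1))} (hp1 : Complex.normSq p.1 = 1) (hp : p.2 ≠ 0)
    (w : ℂ × EuclideanSpace ℝ (Fin (n + 1))) :
    velocity e l (ambientFlow e l b p) (fderiv ℝ (ambientFlow e l b) p w) =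
      dil e (-time e l (dil e b p.2) • l) (dil e b (velocity e l p w)) := by
  obtain ⟨D, hD, hDw⟩ := hasFDerivAt_ambientFlow e hl b hp
  rw [hD.fderiv, hDw, fderiv_unitPoint e hl (dil_ne_zero e b hp), velocity_apply, velocity_apply]
  simp only [ambientFlow]
  set t := time e l (dil e b p.2)
  set t' := fderiv ℝ (time e l) (dil e b p.2) (dil e b w.2)
  have h : (starRingEnd ℂ) (Circle.exp t : ℂ) * (Circle.exp t : ℂ) = 1 := by
    rw [← Complex.normSq_eq_conj_mul_self, Circle.normSq_coe, Complex.ofReal_one]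
  have h' : (starRingEnd ℂ) p.1 * p.1 = 1 := by
    rw [← Complex.normSq_eq_conj_mul_self, hp1, Complex.ofReal_one]
  have key : (starRingEnd ℂ) (p.1 * (Circle.exp t : ℂ)) *
      ((w.1 + t' • (p.1 * Complex.I)) * (Circle.exp t : ℂ)) =
      (starRingEnd ℂ) p.1 * w.1 + t' * Complex.I := by
    rw [map_mul, Complex.real_smul]
    linear_combination ((starRingEnd ℂ) p.1 * w.1 + t' * Complex.I * ((starRingEnd ℂ) p.1 * p.1)) * h +
      t' * Complex.I * h'
  rw [key]
  have h2 : gen e l (unitPoint e l (dil e b p.2)) = dil e (-t • l) (dil e b (gen e l p.2)) := by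
    rw [unitPoint, gen_dil, gen_dil]
  simp only [Complex.add_im, Complex.mul_I_im, Complex.ofReal_re, map_add, map_smul, add_smul, h2]
  abel

/-- The map of `𝕊¹ × 𝕊ⁿ` induced by the homothety `dil e b` of the plane wave. -/
def flow (l b : ℝ × ℝ) (m : Circle × Sph n) : Circle × Sph n :=
  (m.1 * Circle.exp (time e l (dil e b m.2)), toSph (unitPoint e l (dil e b m.2)))

theorem coe_flow_snd (hl : 0 < l.1 ∧ 0 < l.2) (b : ℝ × ℝ) (m : Circle × Sph n) :
    ((flow e l b m).2 : EuclideanSpace ℝ (Fin (n + 1))) = unitPoint e l (dil e b m.2) :=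
  coe_toSph (norm_unitPoint e hl (dil_ne_zero e b (coe_sph_ne_zero m.2)))

theorem emb_flow (hl : 0 < l.1 ∧ 0 < l.2) (b : ℝ × ℝ) (m : Circle × Sph n) :
    emb (flow e l b m) = ambientFlow e l b (emb m) :=
  Prod.ext (Circle.coe_mul _ _) (coe_flow_snd e hl b m)

theorem contMDiffAt_comp_coe_snd {G : Type*} [NormedAddCommGroup G] [NormedSpace ℝ G]
    {k : WithTop ℕ∞} {f : EuclideanSpace ℝ (Fin (n + 1)) → G} {m : Circle × Sph n}
    (hf : ContDiffAt ℝ k f m.2) :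
    ContMDiffAt ((𝓡 1).prod (𝓡 n)) 𝓘(ℝ, G) k (fun m : Circle × Sph n => f m.2) m := by
  have h1 : ContMDiffAt ((𝓡 1).prod (𝓡 n)) (𝓡 n) k (fun m : Circle × Sph n => m.2) m :=
    contMDiffAt_snd
  have h2 : ContMDiffAt ((𝓡 1).prod (𝓡 n)) 𝓘(ℝ, EuclideanSpace ℝ (Fin (n + 1))) k
      (fun m : Circle × Sph n => (m.2 : EuclideanSpace ℝ (Fin (n + 1)))) m :=
    (contMDiff_coe_sph m.2).comp m h1
  exact ContMDiffAt.comp (g := f) m hf.contMDiffAt h2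

theorem contMDiff_flow_time (hl : 0 < l.1 ∧ 0 < l.2) (b : ℝ × ℝ) :
    ContMDiff ((𝓡 1).prod (𝓡 n)) 𝓘(ℝ, ℝ) ∞
      fun m : Circle × Sph n => time e l (dil e b m.2) := by
  intro m
  have h : ContDiffAt ℝ ∞ (fun x => time e l (dil e b x)) (m.2 : EuclideanSpace ℝ (Fin (n + 1))) :=
    (contDiffAt_time e hl (dil_ne_zero e b (coe_sph_ne_zero m.2))).comp _ (dil e b).contDiff.contDiffAt
  exact contMDiffAt_comp_coe_snd h

theorem contMDiff_flow (hl : 0 < l.1 ∧ 0 < l.2) (b : ℝ × ℝ) :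
    ContMDiff ((𝓡 1).prod (𝓡 n)) ((𝓡 1).prod (𝓡 n)) ∞ (flow e l b) := by
  have h1 : ContMDiff ((𝓡 1).prod (𝓡 n)) (𝓡 1) ∞ (fun m : Circle × Sph n => m.1) := contMDiff_fst
  have h2 : ContMDiff ((𝓡 1).prod (𝓡 n)) (𝓡 1) ∞
      (fun m : Circle × Sph n => Circle.exp (time e l (dil e b m.2))) :=
    contMDiff_circleExp.comp (contMDiff_flow_time e hl b)
  refine (h1.mul h2).prodMk fun m => ?_
  have h3 : ContDiffAt ℝ ∞ (fun x => unitPoint e l (dil e b x))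
      (m.2 : EuclideanSpace ℝ (Fin (n + 1))) :=
    (contDiffAt_unitPoint e hl (dil_ne_zero e b (coe_sph_ne_zero m.2))).comp _
      (dil e b).contDiff.contDiffAt
  have h4 : ContMDiffAt ((𝓡 1).prod (𝓡 n)) 𝓘(ℝ, EuclideanSpace ℝ (Fin (n + 1))) ∞
      (fun m : Circle × Sph n => unitPoint e l (dil e b m.2)) m :=
    contMDiffAt_comp_coe_snd (f := fun x => unitPoint e l (dil e b x)) h3
  exact contMDiffAt_toSph (f := fun m : Circle × Sph n => unitPoint e l (dil e b m.2)) h4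
    (Filter.Eventually.of_forall fun x =>
      norm_unitPoint e hl (dil_ne_zero e b (coe_sph_ne_zero x.2)))

theorem flow_flow (hl : 0 < l.1 ∧ 0 < l.2) (a b : ℝ × ℝ) (m : Circle × Sph n) :
    flow e l a (flow e l b m) = flow e l (a + b) m := by
  have h := dil_ne_zero e b (coe_sph_ne_zero m.2)
  refine Prod.ext ?_ (Subtype.ext ?_)
  · change m.1 * Circle.exp (time e l (dil e b m.2)) *
      Circle.exp (time e l (dil e a (flow e l b m).2)) =
        m.1 * Circle.exp (time e l (dil e (a + b) m.2))
    rw [coe_flow_snd e hl, time_dil_unitPoint e hl a h, dil_add, mul_assoc, ← Circle.exp_add,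
      add_sub_cancel]
  · rw [coe_flow_snd e hl, coe_flow_snd e hl, coe_flow_snd e hl, unitPoint_dil_unitPoint e hl a h,
      dil_add]

theorem flow_zero (hl : 0 < l.1 ∧ 0 < l.2) (m : Circle × Sph n) : flow e l 0 m = m := by
  have h := time_of_norm_eq_one e hl (norm_coe_sph m.2)
  refine Prod.ext ?_ (Subtype.ext ?_)
  · simp [flow, dil_zero, h]
  · rw [coe_flow_snd e hl, dil_zero, unitPoint, h, neg_zero, zero_smul, dil_zero]

/-- `flow e l b` as a diffeomorphism. -/
def flowDiffeo (hl : 0 < l.1 ∧ 0 < l.2) (b : ℝ × ℝ) :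
    (Circle × Sph n) ≃ₘ^∞⟮(𝓡 1).prod (𝓡 n), (𝓡 1).prod (𝓡 n)⟯ (Circle × Sph n) where
  toFun := flow e l b
  invFun := flow e l (-b)
  left_inv m := by rw [flow_flow e hl, neg_add_cancel, flow_zero e hl]
  right_inv m := by rw [flow_flow e hl, add_neg_cancel, flow_zero e hl]
  contMDiff_toFun := contMDiff_flow e hl b
  contMDiff_invFun := contMDiff_flow e hl (-b)

theorem frame_flow (hl : 0 < l.1 ∧ 0 < l.2) (b : ℝ × ℝ) (m : Circle × Sph n)
    (u : TangentSpace ((𝓡 1).prod (𝓡 n)) m) :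
    frame e l (flow e l b m) (mfderiv ((𝓡 1).prod (𝓡 n)) ((𝓡 1).prod (𝓡 n)) (flow e l b) m u) =
      dil e (-time e l (dil e b m.2) • l) (dil e b (frame e l m u)) := by
  obtain ⟨D, hD, -⟩ := hasFDerivAt_ambientFlow e hl b (p := emb m) (coe_sph_ne_zero m.2)
  have h1 := mvfderiv_comp_mfderiv (mdifferentiable_emb (flow e l b m))
    ((contMDiff_flow e hl b).mdifferentiable (by simp) m) u
  have h2 := mvfderiv_comp_fderiv hD.differentiableAt (mdifferentiable_emb m) u
  simp only [emb_flow e hl] at h1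
  have h3 : mvfderiv ((𝓡 1).prod (𝓡 n)) emb (flow e l b m)
      (mfderiv ((𝓡 1).prod (𝓡 n)) ((𝓡 1).prod (𝓡 n)) (flow e l b) m u) =
      fderiv ℝ (ambientFlow e l b) (emb m) (mvfderiv ((𝓡 1).prod (𝓡 n)) emb m u) := h1.symm.trans h2
  refine (congrArg (velocity e l (emb (flow e l b m))) h3).trans ?_
  rw [emb_flow e hl]
  exact velocity_ambientFlow e hl b (Circle.normSq_coe m.1) (coe_sph_ne_zero m.2) _

theorem field_flow (hl : 0 < l.1 ∧ 0 < l.2) (b : ℝ × ℝ) (m : Circle × Sph n)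
    (u v : TangentSpace ((𝓡 1).prod (𝓡 n)) m) :
    field e l (flow e l b m)
      (mfderiv ((𝓡 1).prod (𝓡 n)) ((𝓡 1).prod (𝓡 n)) (flow e l b) m u)
      (mfderiv ((𝓡 1).prod (𝓡 n)) ((𝓡 1).prod (𝓡 n)) (flow e l b) m v) =
      Real.exp (2 * (b.1 + b.2) - 2 * (l.1 + l.2) * time e l (dil e b m.2)) * field e l m u v := by
  rw [field_apply, frame_flow e hl, frame_flow e hl, coe_flow_snd e hl, unitPoint, metric_dil,
    metric_dil, ← mul_assoc, ← Real.exp_add, field_apply]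
  congr 2
  simp
  ring

theorem flowDiffeo_mem_conformalGroup (hl : 0 < l.1 ∧ 0 < l.2) (b : ℝ × ℝ) :
    flowDiffeo e hl b ∈ PseudoConformal.conformalGroup ((𝓡 1).prod (𝓡 n)) (field e l) := by
  refine ⟨fun m => Real.exp (2 * (b.1 + b.2) - 2 * (l.1 + l.2) * time e l (dil e b m.2)), ?_,
    fun m => Real.exp_pos _, fun m => ?_⟩
  · have h : ContDiff ℝ ∞ fun t : ℝ => Real.exp (2 * (b.1 + b.2) - 2 * (l.1 + l.2) * t) := by
      fun_prop
    exact h.contMDiff.comp (contMDiff_flow_time e hl b)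
  · exact ContinuousLinearMap.ext fun u => ContinuousLinearMap.ext fun v => field_flow e hl b m u v

theorem exists_field_ne_zero (hl : 0 < l.1 ∧ 0 < l.2) (m : Circle × Sph n) :
    ∃ u v, field e l m u v ≠ 0 := by
  obtain ⟨L, hL⟩ := exists_stdForm_field e hl m
  refine ⟨L.symm (Pi.single (.inl 0) 1), L.symm (Pi.single (.inl 0) 1), ?_⟩
  rw [hL]
  simp [PseudoConformal.stdForm, Pi.single_apply]

/-- The homothety with parameter `(2, -1)` fixes `vec e 0` and scales the metric by `exp 2` there,
so that it fixes a point of `𝕊¹ × 𝕊ⁿ` without being isometric at this point for any metric of the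
class. -/
theorem isEssential_field (hl : 0 < l.1 ∧ 0 < l.2) :
    PseudoConformal.IsEssential ((𝓡 1).prod (𝓡 n)) (field e l) := by
  rintro ⟨h, ⟨c, -, hc, hh⟩, hinv⟩
  let m : Circle × Sph n := (1, toSph (vec e 0))
  have hm2 : (m.2 : EuclideanSpace ℝ (Fin (n + 1))) = vec e 0 := coe_toSph (by simp [vec])
  have hdil : dil e (2, -1) (m.2 : EuclideanSpace ℝ (Fin (n + 1))) = m.2 := by
    ext i
    rw [dil_apply]
    by_cases hi : i = e (.inl 0)
    · rw [hi, weight_inl_zero]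
      norm_num
    · simp [hm2, vec, hi]
  have ht : time e l (dil e (2, -1) (m.2 : EuclideanSpace ℝ (Fin (n + 1)))) = 0 := by
    rw [hdil]
    exact time_of_norm_eq_one e hl (norm_coe_sph m.2)
  have hfix : flow e l (2, -1) m = m := by
    refine Prod.ext ?_ (Subtype.ext ?_)
    · change m.1 * Circle.exp (time e l (dil e (2, -1) m.2)) = m.1
      rw [ht, Circle.exp_zero, mul_one]
    · rw [coe_flow_snd e hl, unitPoint, ht, neg_zero, zero_smul, dil_zero, hdil]
  obtain ⟨u, v, huv⟩ := exists_field_ne_zero e hl m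
  have h1 := hinv _ (flowDiffeo_mem_conformalGroup e hl (2, -1))
  have h2 : h (flow e l (2, -1) m)
      (mfderiv ((𝓡 1).prod (𝓡 n)) ((𝓡 1).prod (𝓡 n)) (flow e l (2, -1)) m u)
      (mfderiv ((𝓡 1).prod (𝓡 n)) ((𝓡 1).prod (𝓡 n)) (flow e l (2, -1)) m v) = h m u v :=
    congrArg (fun g : PseudoConformal.BilinField ((𝓡 1).prod (𝓡 n)) (Circle × Sph n) => g m u v) h1
  have h3 : ∀ y (a b : TangentSpace ((𝓡 1).prod (𝓡 n)) y), h y a b = c y * field e l y a b :=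
    fun y a b => by rw [hh]; rfl
  rw [h3, h3, field_flow e hl, ht, hfix] at h2
  have h4 := mul_left_cancel₀ (hc m).ne' h2
  have h5 := mul_right_cancel₀ huv (h4.trans (one_mul _).symm)
  norm_num at h5

end

/-! ### Strong essentiality and non-flatness -/

section

variable {n r s : ℕ} (e : Fin 4 ⊕ (Fin r ⊕ Fin s) ≃ Fin (n + 1)) {l : ℝ × ℝ}

/-- A function on `{x₀ > 0, x₃ > 0}` that is invariant under the flow of `gen e l` and is
translated by the other homotheties. -/
def height (l : ℝ × ℝ) (x : EuclideanSpace ℝ (Fin (n + 1))) : ℝ :=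
  l.2 * Real.log (coord e 0 x) - (l.1 + 2 * l.2) * Real.log (coord e 3 x)

theorem height_dil (l b : ℝ × ℝ) {x : EuclideanSpace ℝ (Fin (n + 1))} (h0 : 0 < coord e 0 x)
    (h3 : 0 < coord e 3 x) :
    height e l (dil e b x) = height e l x + (l.2 * b.1 - l.1 * b.2) := by
  simp only [height, coord_dil, weight_inl_zero, weight_inl_three]
  rw [Real.log_mul (Real.exp_pos _).ne' h0.ne', Real.log_mul (Real.exp_pos _).ne' h3.ne',
    Real.log_exp, Real.log_exp]
  ring

theorem coord_dil_pos (b : ℝ × ℝ) (x : EuclideanSpace ℝ (Fin (n + 1))) (k : Fin 4) :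
    0 < coord e k (dil e b x) ↔ 0 < coord e k x := by
  rw [coord_dil, mul_pos_iff_of_pos_left (Real.exp_pos _)]

/-- The points of `{x₀ > 0, x₃ > 0}` with height in an interval whose length is the translation of
the height by the homothety with parameter `(2, -1)`. -/
def band (l : ℝ × ℝ) (a : ℝ) : Set (EuclideanSpace ℝ (Fin (n + 1))) :=
  {x | (0 < coord e 0 x ∧ 0 < coord e 3 x) ∧ height e l x ∈ Ioo a (a + (l.1 + 2 * l.2))}

theorem isOpen_band (l : ℝ × ℝ) (a : ℝ) : IsOpen (band e l a) := by
  have h1 : IsOpen {x : EuclideanSpace ℝ (Fin (n + 1)) | 0 < coord e 0 x ∧ 0 < coord e 3 x} :=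
    (isOpen_lt continuous_const (coord e 0).continuous).inter
      (isOpen_lt continuous_const (coord e 3).continuous)
  have h2 : ContinuousOn (height e l) {x | 0 < coord e 0 x ∧ 0 < coord e 3 x} := by
    unfold height
    refine ContinuousOn.sub (continuousOn_const.mul (ContinuousOn.log (by fun_prop) ?_))
      (continuousOn_const.mul (ContinuousOn.log (by fun_prop) ?_))
    · exact fun x hx => hx.1.ne'
    · exact fun x hx => hx.2.ne'
  exact h2.isOpen_inter_preimage h1 isOpen_Ioo

theorem dil_mem_band (l b : ℝ × ℝ) (a : ℝ) (x : EuclideanSpace ℝ (Fin (n + 1))) :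
    dil e b x ∈ band e l a ↔ x ∈ band e l (a - (l.2 * b.1 - l.1 * b.2)) := by
  simp only [band, mem_ofPred_eq, coord_dil_pos]
  refine and_congr_right fun h => ?_
  rw [height_dil e l b h.1 h.2, mem_Ioo, mem_Ioo]
  constructor <;> rintro ⟨h1, h2⟩ <;> constructor <;> linarith

/-- The iterates of the homothety with parameter `(2, -1)` have a wandering nonempty open set,
which has measure zero for every invariant finite measure. -/
theorem isStronglyEssential_field (hl : 0 < l.1 ∧ 0 < l.2) :
    PseudoConformal.IsStronglyEssential ((𝓡 1).prod (𝓡 n)) (field e l) := by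
  intro _ _ μ _ _ hμ
  have hcont : Continuous fun m : Circle × Sph n => (m.2 : EuclideanSpace ℝ (Fin (n + 1))) := by
    fun_prop
  let A : ℝ → Set (Circle × Sph n) := fun a => {m | (m.2 : EuclideanSpace ℝ (Fin (n + 1))) ∈ band e l a}
  have hA : ∀ a, IsOpen (A a) := fun a => (isOpen_band e l a).preimage hcont
  have hκ : 0 < l.1 + 2 * l.2 := by linarith [hl.1, hl.2]
  -- a point of the sphere in the domain of the height function
  let x : EuclideanSpace ℝ (Fin (n + 1)) := unitPoint e l (vec e 0 + vec e 3)
  have hne : vec e 0 + vec e 3 ≠ 0 := fun h => by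
    have := congrArg (coord e 0) h
    simp [coord_vec] at this
  have hx : (0 < coord e 0 x ∧ 0 < coord e 3 x) := by
    constructor <;> refine (coord_dil_pos e _ _ _).2 ?_ <;> simp [coord_vec]
  let a := height e l x - (l.1 + 2 * l.2) / 2
  have hpos : μ (A a) ≠ 0 := by
    refine ((hA a).measure_pos μ ⟨(1, toSph x), ?_⟩).ne'
    have h1 : (toSph x : EuclideanSpace ℝ (Fin (n + 1))) = x := coe_toSph (norm_unitPoint e hl hne)
    change (toSph x : EuclideanSpace ℝ (Fin (n + 1))) ∈ band e l a
    rw [h1]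
    exact ⟨hx, by constructor <;> simp only [a] <;> linarith⟩
  -- its preimages under the iterates of the flow are pairwise disjoint
  let B : ℕ → Set (Circle × Sph n) := fun k => A (a - k * (l.1 + 2 * l.2))
  have hB : ∀ k, μ (B k) = μ (A a) := fun k => by
    have h1 := hμ _ (flowDiffeo_mem_conformalGroup e hl ((k : ℝ) • (2, -1)))
    have h2 : Measurable (flowDiffeo e hl ((k : ℝ) • (2, -1))) :=
      (flowDiffeo e hl ((k : ℝ) • (2, -1))).continuous.measurable
    refine Eq.trans ?_ ((Measure.map_apply h2 (hA a).measurableSet).symm.trans (by rw [h1]))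
    congr 1
    ext m
    refine Iff.symm ?_
    change ((flow e l ((k : ℝ) • (2, -1)) m).2 : EuclideanSpace ℝ (Fin (n + 1))) ∈ band e l a ↔
      (m.2 : EuclideanSpace ℝ (Fin (n + 1))) ∈ band e l (a - k * (l.1 + 2 * l.2))
    rw [coe_flow_snd e hl, unitPoint, dil_mem_band, dil_mem_band]
    have : ∀ t : ℝ, a - (l.2 * (-t • l).1 - l.1 * (-t • l).2) -
        (l.2 * ((k : ℝ) • ((2 : ℝ), (-1 : ℝ))).1 - l.1 * ((k : ℝ) • ((2 : ℝ), (-1 : ℝ))).2) =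
        a - k * (l.1 + 2 * l.2) := fun t => by
      simp
      ring
    rw [this]
  have hdisj : Pairwise (Function.onFun Disjoint B) := by
    intro i j hij
    rw [Function.onFun, Set.disjoint_left]
    rintro m ⟨-, h1, h2⟩ ⟨-, h3, h4⟩
    rcases lt_or_gt_of_ne hij with h | h
    · have : (i : ℝ) + 1 ≤ j := by exact_mod_cast h
      nlinarith
    · have : (j : ℝ) + 1 ≤ i := by exact_mod_cast h
      nlinarith
  have hsum := tsum_measure_le_measure_univ (μ := μ) (s := B)
    (fun k => (hA _).measurableSet.nullMeasurableSet) (fun i j hij => (hdisj hij).aedisjoint)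
  simp only [hB, ENNReal.tsum_const_eq_top_of_ne_zero hpos] at hsum
  exact measure_ne_top μ univ (top_le_iff.1 hsum)

theorem not_isConformallyFlat_field (hl : 0 < l.1 ∧ 0 < l.2) :
    ¬ PseudoConformal.IsConformallyFlat ((𝓡 1).prod (𝓡 n)) (r + 2) (s + 2) (field e l) := by
  intro hflat
  have hne : vec e 0 ≠ 0 := fun h => by
    have := congrArg (coord e 0) h
    simp [coord_vec] at this
  obtain ⟨U, hU, hxU, f, c, hf, hc, h⟩ := hflat (proj e l (vec e 0))
  let V : Set (EuclideanSpace ℝ (Fin (n + 1))) := {x | x ≠ 0} ∩ proj e l ⁻¹' U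
  have hproj : ContMDiffOn 𝓘(ℝ, EuclideanSpace ℝ (Fin (n + 1))) ((𝓡 1).prod (𝓡 n)) ∞ (proj e l)
      {x | x ≠ 0} := fun x hx => (contMDiffAt_proj e hl hx).contMDiffWithinAt
  have hV : IsOpen V := hproj.continuousOn.isOpen_inter_preimage isOpen_ne hU
  have hfV : ContDiffOn ℝ ∞ (fun x => f (proj e l x)) V :=
    (hf.comp (hproj.mono inter_subset_left) inter_subset_right).contDiffOn
  have hcV : ContDiffOn ℝ ∞ (fun x => c (proj e l x)) V :=
    (hc.comp (hproj.mono inter_subset_left) inter_subset_right).contDiffOn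
  let T := (stdEquiv e).symm.toLinearMap.toContinuousLinearMap
  have hT : ∀ w, stdEquiv e (T w) = w := (stdEquiv e).apply_symm_apply
  have htime : ContDiffOn ℝ ∞ (fun x => Real.exp (2 * (-time e l x * (l.1 + l.2)))) V := by
    intro x hx
    have h1 : ContDiff ℝ ∞ fun t : ℝ => Real.exp (2 * (-t * (l.1 + l.2))) := by fun_prop
    exact (h1.contDiffAt.comp x (contDiffAt_time e hl hx.1)).contDiffWithinAt
  refine not_conformal_to_flat e hV (x := vec e 0) ⟨hne, hxU⟩ (T.contDiff.comp_contDiffOn hfV)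
    (hcV.mul htime) ?_ ?_
  · exact mul_ne_zero (h _ hxU).1.ne' (Real.exp_pos _).ne'
  · intro y hy u v
    have hfy : MDifferentiableAt ((𝓡 1).prod (𝓡 n)) 𝓘(ℝ, Fin (r + 2) ⊕ Fin (s + 2) → ℝ) f
        (proj e l y) :=
      (hf.contMDiffAt (hU.mem_nhds hy.2)).mdifferentiableAt (by simp)
    have hD : ∀ w, stdEquiv e (fderiv ℝ (fun x => T (f (proj e l x))) y w) =
        mfderiv ((𝓡 1).prod (𝓡 n)) 𝓘(ℝ, Fin (r + 2) ⊕ Fin (s + 2) → ℝ) f (proj e l y)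
          (mfderiv 𝓘(ℝ, EuclideanSpace ℝ (Fin (n + 1))) ((𝓡 1).prod (𝓡 n)) (proj e l) y w) := by
      intro w
      have h1 := (hfV.contDiffAt (hV.mem_nhds hy)).differentiableAt (by simp)
      have h2 := (T.hasFDerivAt.comp y h1.hasFDerivAt).fderiv
      have h3 := mvfderiv_comp_mfderiv hfy
        ((contMDiffAt_proj e hl hy.1).mdifferentiableAt (by simp)) w
      rw [mvfderiv_eq_fderiv] at h3
      refine Eq.trans ?_ h3
      refine (congrArg (fun L => stdEquiv e (L w)) h2).trans ?_
      exact hT _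
    refine (stdForm_stdEquiv e _ _).symm.trans ?_
    refine (congrArg₂ (PseudoConformal.stdForm _ _) (hD u) (hD v)).trans ?_
    refine ((h _ hy.2).2 _ _).trans ?_
    rw [field_proj e hl hy.1, mul_assoc]

end

/-! ### Rigidity of conformal maps of the half-space -/

section

section Lift

variable {V : Type*} [NormedAddCommGroup V] [NormedSpace ℝ V]

/-- A smooth map from a convex open set to the circle lifts to a smooth angle function. -/
theorem exists_contDiffOn_angle {U : Set V} (hU : IsOpen U) (hUc : Convex ℝ U) (hne : U.Nonempty)
    {z : V → Circle} (hz : ContDiffOn ℝ ∞ (fun x => (z x : ℂ)) U) :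
    ∃ t : V → ℝ, ContDiffOn ℝ ∞ t U ∧ ∀ x ∈ U, Circle.exp (t x) = z x := by
  have hsc : IsSimplyConnected U :=
    have := hUc.contractibleSpace hne
    SimplyConnectedSpace.ofContractible U
  obtain ⟨g, hgc, hg⟩ := Complex.exists_continuousOn_eqOn_exp_comp hsc hU hz.continuousOn (by
    rintro ⟨x, -, hx⟩
    exact Circle.coe_ne_zero _ hx)
  have hg' : ∀ x ∈ U, Complex.exp (g x) = z x := hg
  have hgs : ContDiffOn ℝ ∞ g U := by
    intro x hx
    have h1 : ContDiffAt ℝ ∞ (fun y => Complex.log ((z y : ℂ) / z x)) x := by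
      have h2 : ContDiffAt ℝ ∞ Complex.log ((z x : ℂ) / z x) := by
        rw [div_self (Circle.coe_ne_zero _)]
        exact (Complex.contDiffAt_log Complex.one_mem_slitPlane).restrict_scalars ℝ
      exact h2.comp x ((hz.contDiffAt (hU.mem_nhds hx)).div_const _)
    refine ((contDiffAt_const (c := g x)).add h1).contDiffWithinAt.congr_of_eventuallyEq_of_mem ?_ hx
    have h3 : ContinuousAt (fun y => (g y - g x).im) x :=
      Complex.continuous_im.continuousAt.comp
        ((hgc.continuousAt (hU.mem_nhds hx)).sub continuousAt_const)
    have h4 : ∀ᶠ y in 𝓝 x, |(g y - g x).im| < Real.pi := by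
      refine h3.abs.eventually_lt_const ?_
      simpa using Real.pi_pos
    refine Filter.Eventually.filter_mono nhdsWithin_le_nhds ?_
    filter_upwards [h4, hU.mem_nhds hx] with y hy hyU
    rw [← hg' y hyU, ← hg' x hx, ← Complex.exp_sub,
      Complex.log_exp (abs_lt.1 hy).1 (abs_lt.1 hy).2.le, add_sub_cancel]
  refine ⟨fun x => (g x).im, Complex.imCLM.contDiff.comp_contDiffOn hgs, fun x hx => ?_⟩
  have h1 := hg' x hx
  have h2 : (g x).re = 0 := by
    have h3 := congrArg norm h1
    rw [Complex.norm_exp, Circle.norm_coe] at h3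
    exact Real.exp_eq_one_iff _ |>.1 h3
  apply Circle.ext
  rw [Circle.coe_exp, ← h1]
  congr 1
  apply Complex.ext <;> simp [h2]

theorem eq_of_fderiv_eq_zero_on_segment {U : Set V} (hU : IsOpen U) (hUc : Convex ℝ U) {f : V → ℝ}
    (hf : ContDiffOn ℝ ∞ f U) {x y : V} (hx : x ∈ U) (hy : y ∈ U)
    (h : ∀ w ∈ U, fderiv ℝ f w (y - x) = 0) : f x = f y := by
  obtain ⟨w, hw, h1⟩ := domain_mvt (f' := fderiv ℝ f) (s := U) (f := f) (fun w hw =>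
    ((hf.contDiffAt (hU.mem_nhds hw)).differentiableAt (by simp)).hasFDerivAt.hasFDerivWithinAt)
    hUc hx hy
  rw [h w (hUc.segment_subset hx hy hw)] at h1
  linarith

end Lift

section Rigidity

variable {ι : Type*} [Fintype ι] [DecidableEq ι] {r s : ℕ} (e : Fin 4 ⊕ (Fin r ⊕ Fin s) ≃ ι)

theorem eq_zero_of_metric {x u : EuclideanSpace ℝ ι} (h : ∀ v, metric e 1 x u v = 0) : u = 0 := by
  have h2 : coord e 2 u = 0 := by
    have := h (vec e 0)
    rw [metric_apply, form_vec] at this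
    simpa [coord_vec] using this
  refine eq_zero_of_form e fun v => ?_
  have := h v
  rw [metric_apply, h2] at this
  simpa using this

theorem surjective_of_metric {c : ℝ} (hc : c ≠ 0) {x y : EuclideanSpace ℝ ι}
    {L : EuclideanSpace ℝ ι →L[ℝ] EuclideanSpace ℝ ι}
    (h : ∀ u v, metric e 1 y (L u) (L v) = c * metric e 1 x u v) : Function.Surjective L := by
  have hinj : Function.Injective L.toLinearMap := by
    rw [injective_iff_map_eq_zero]
    intro u hu
    refine eq_zero_of_metric e (x := x) fun v => ?_
    have h1 := h u v
    rw [show L u = 0 from hu] at h1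
    simpa [hc] using h1.symm
  exact LinearMap.injective_iff_surjective.1 hinj

/-- The half-space `x₀ > 0`, which is convex and invariant under the homotheties. -/
def halfSpace : Set (EuclideanSpace ℝ ι) := {x | 0 < coord e 0 x}

theorem isOpen_halfSpace : IsOpen (halfSpace e) := isOpen_lt continuous_const (coord e 0).continuous

theorem convex_halfSpace : Convex ℝ (halfSpace e) :=
  convex_halfSpace_gt (coord e 0).toLinearMap.isLinear 0

theorem dil_mem_halfSpace (b : ℝ × ℝ) {x : EuclideanSpace ℝ ι} (hx : x ∈ halfSpace e) :
    dil e b x ∈ halfSpace e := by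
  change 0 < coord e 0 _
  rw [coord_dil]
  exact mul_pos (Real.exp_pos _) hx

/-- A conformal map `F` of the half-space that intertwines the homotheties `dil e l` and `dil e m`
induces a local diffeomorphism in the coordinates `(x₂, x₃)`, as it preserves `dx₂ = dx₃ = 0`. This
local diffeomorphism intertwines the diagonal maps with exponents `l` and `m`. Its derivative at the
fixed point `0` of the first one has no zero row, and compares the exponents. -/
theorem weights_of_intertwining {F : EuclideanSpace ℝ ι → EuclideanSpace ℝ ι}
    {c : EuclideanSpace ℝ ι → ℝ} (hF : ContDiffOn ℝ ∞ F (halfSpace e))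
    (hc : ContDiffOn ℝ ∞ c (halfSpace e)) (hc0 : ∀ x ∈ halfSpace e, c x ≠ 0)
    (h : ∀ y ∈ halfSpace e, ∀ u v, metric e 1 (F y) (fderiv ℝ F y u) (fderiv ℝ F y v) =
      c y * metric e 1 y u v)
    {l m : ℝ × ℝ} (hlm : ∀ᶠ x in 𝓝 (vec e 0), F (dil e l x) = dil e m (F x)) :
    (m.1 = l.1 ∨ m.1 = l.2) ∧ (m.2 = l.1 ∨ m.2 = l.2) := by
  have hx0 : vec e 0 ∈ halfSpace e := by
    change 0 < coord e 0 _
    simp [coord_vec]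
  have hd : ∀ x ∈ halfSpace e, DifferentiableAt ℝ F x := fun x hx =>
    (hF.contDiffAt ((isOpen_halfSpace e).mem_nhds hx)).differentiableAt (by simp)
  have hfd : ∀ j : Fin 4, ∀ x ∈ halfSpace e, ∀ u, fderiv ℝ (fun y => coord e j (F y)) x u =
      coord e j (fderiv ℝ F x u) := fun j x hx u =>
    congrArg (fun L : EuclideanSpace ℝ ι →L[ℝ] ℝ => L u)
      ((coord e j).hasFDerivAt.comp x (hd x hx).hasFDerivAt).fderiv
  have hker : ∀ j : Fin 4, j = 2 ∨ j = 3 → ∀ x ∈ halfSpace e, ∀ u, coord e 2 u = 0 →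
      coord e 3 u = 0 → coord e j (fderiv ℝ F x u) = 0 := by
    intro j hj x hx u h2 h3
    have := kernel_of_conformal_map e (isOpen_halfSpace e) hx hF hc (hc0 x hx) h h2 h3
    rcases hj with rfl | rfl
    exacts [this.1, this.2]
  -- the components `2` and `3` of `F` depend only on the coordinates `2` and `3`
  have hdep : ∀ j : Fin 4, j = 2 ∨ j = 3 → ∀ x ∈ halfSpace e, ∀ y ∈ halfSpace e,
      coord e 2 x = coord e 2 y → coord e 3 x = coord e 3 y →
      coord e j (F x) = coord e j (F y) := by
    intro j hj x hx y hy h2 h3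
    refine eq_of_fderiv_eq_zero_on_segment (f := fun y => coord e j (F y)) (isOpen_halfSpace e)
      (convex_halfSpace e) ((coord e j).contDiff.comp_contDiffOn hF) hx hy fun w hw => ?_
    rw [hfd j w hw]
    exact hker j hj w hw _ (by rw [map_sub, h2, sub_self]) (by rw [map_sub, h3, sub_self])
  -- the derivatives of these components along the two coordinate directions
  have hscale : ∀ j : Fin 4, j = 2 ∨ j = 3 → ∀ i : Fin 4, i = 2 ∨ i = 3 →
      coord e j (fderiv ℝ F (vec e 0) (vec e i)) ≠ 0 →
      weight e m (e (.inl j)) = weight e l (e (.inl i)) := by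
    intro j hj i hi hne
    let γ : ℝ → EuclideanSpace ℝ ι := fun t => vec e 0 + t • vec e i
    have hγ0 : γ 0 = vec e 0 := by simp [γ]
    have hγ : ∀ t, γ t ∈ halfSpace e := by
      intro t
      change 0 < coord e 0 _
      rcases hi with rfl | rfl <;> simp [γ, coord_vec]
    let a := coord e j (fderiv ℝ F (vec e 0) (vec e i))
    have hda : HasDerivAt (fun t => coord e j (F (γ t))) a 0 := by
      have h1 : HasDerivAt γ (vec e i) 0 :=
        (((hasDerivAt_id (0 : ℝ)).smul_const (vec e i)).const_add (vec e 0)).congr_deriv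
          (one_smul ℝ _)
      have h2 := (hd _ hx0).hasFDerivAt
      rw [← hγ0] at h2
      have h3 := (coord e j).hasFDerivAt.comp_hasDerivAt (0 : ℝ) (h2.comp_hasDerivAt (0 : ℝ) h1)
      rw [hγ0] at h3
      exact h3
    have hEl : HasDerivAt (fun t => coord e j (F (γ (Real.exp (weight e l (e (.inl i))) * t))))
        (a * Real.exp (weight e l (e (.inl i)))) 0 := by
      have h1 : HasDerivAt (fun t : ℝ => Real.exp (weight e l (e (.inl i))) * t)
          (Real.exp (weight e l (e (.inl i)))) 0 := by
        simpa using (hasDerivAt_id (0 : ℝ)).const_mul (Real.exp (weight e l (e (.inl i))))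
      exact HasDerivAt.comp (h₂ := fun t => coord e j (F (γ t))) 0 (by rwa [mul_zero]) h1
    have hEm : HasDerivAt (fun t => Real.exp (weight e m (e (.inl j))) * coord e j (F (γ t)))
        (Real.exp (weight e m (e (.inl j))) * a) 0 := hda.const_mul _
    have heq : (fun t => coord e j (F (γ (Real.exp (weight e l (e (.inl i))) * t)))) =ᶠ[𝓝 0]
        fun t => Real.exp (weight e m (e (.inl j))) * coord e j (F (γ t)) := by
      have hc : Filter.Tendsto γ (𝓝 0) (𝓝 (vec e 0)) := by
        rw [← hγ0]
        exact Continuous.tendsto (by fun_prop) 0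
      filter_upwards [hc.eventually hlm] with t ht
      rw [← coord_dil, ← ht]
      refine hdep j hj _ (hγ _) _ (dil_mem_halfSpace e l (hγ t)) ?_ ?_ <;>
        rcases hi with rfl | rfl <;> simp [γ, coord_vec, coord_dil, mul_comm]
    have := hEl.unique (hEm.congr_of_eventuallyEq heq)
    have h4 : Real.exp (weight e m (e (.inl j))) = Real.exp (weight e l (e (.inl i))) := by
      refine mul_right_cancel₀ (b := a) hne ?_
      rw [← this, mul_comm]
    exact Real.exp_injective h4
  have hrow : ∀ j : Fin 4, j = 2 ∨ j = 3 → weight e m (e (.inl j)) = l.1 ∨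
      weight e m (e (.inl j)) = l.2 := by
    intro j hj
    by_contra! hcon
    have h2 : coord e j (fderiv ℝ F (vec e 0) (vec e 2)) = 0 := by
      by_contra hne
      exact hcon.1 (by simpa using hscale j hj 2 (.inl rfl) hne)
    have h3 : coord e j (fderiv ℝ F (vec e 0) (vec e 3)) = 0 := by
      by_contra hne
      exact hcon.2 (by simpa using hscale j hj 3 (.inr rfl) hne)
    obtain ⟨u, hu⟩ := surjective_of_metric e (hc0 _ hx0) (h _ hx0) (vec e j)
    have h4 := hker j hj _ hx0 (u - coord e 2 u • vec e 2 - coord e 3 u • vec e 3)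
      (by simp [coord_vec]) (by simp [coord_vec])
    simp only [map_sub, map_smul, h2, h3, hu, coord_vec] at h4
    simp at h4
  exact ⟨by simpa using hrow 2 (.inl rfl), by simpa using hrow 3 (.inr rfl)⟩

end Rigidity

end

/-! ### Conformal inequivalence -/

section

variable {n r s : ℕ} (e : Fin 4 ⊕ (Fin r ⊕ Fin s) ≃ Fin (n + 1)) {l m : ℝ × ℝ}

theorem proj_dil (hl : 0 < l.1 ∧ 0 < l.2) {x : EuclideanSpace ℝ (Fin (n + 1))} (hx : x ≠ 0) :
    proj e l (dil e ((2 * Real.pi) • l) x) = proj e l x := by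
  simp only [proj, time_dil_smul e hl _ hx, unitPoint_dil_smul e hl _ hx, Circle.exp_add,
    Circle.exp_two_pi, mul_one]

theorem ne_zero_of_mem_halfSpace {x : EuclideanSpace ℝ (Fin (n + 1))} (hx : x ∈ halfSpace e) :
    x ≠ 0 := by
  rintro rfl
  have : 0 < coord e 0 (0 : EuclideanSpace ℝ (Fin (n + 1))) := hx
  simp at this

/-- A map of `𝕊¹ × 𝕊ⁿ`, composed with the projection and restricted to the half-space, in polar
coordinates. -/
theorem exists_polar (hl : 0 < l.1 ∧ 0 < l.2) {f : Circle × Sph n → Circle × Sph n}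
    (hf : ContMDiff ((𝓡 1).prod (𝓡 n)) ((𝓡 1).prod (𝓡 n)) ∞ f) :
    ∃ (t : EuclideanSpace ℝ (Fin (n + 1)) → ℝ)
      (w : EuclideanSpace ℝ (Fin (n + 1)) → EuclideanSpace ℝ (Fin (n + 1))),
      ContDiffOn ℝ ∞ t (halfSpace e) ∧ ContDiffOn ℝ ∞ w (halfSpace e) ∧
      (∀ x, ((f (proj e l x)).2 : EuclideanSpace ℝ (Fin (n + 1))) = w x) ∧
      ∀ x ∈ halfSpace e, Circle.exp (t x) = (f (proj e l x)).1 := by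
  have hG : ContDiffOn ℝ ∞ (fun x => emb (f (proj e l x))) (halfSpace e) := by
    intro x hx
    have h1 := (hf _).comp x (contMDiffAt_proj e hl (ne_zero_of_mem_halfSpace e hx))
    exact (ContMDiffAt.comp x (contMDiff_emb _) h1).contDiffAt.contDiffWithinAt
  have hne : (halfSpace e).Nonempty := ⟨vec e 0, by
    change 0 < coord e 0 _
    simp [coord_vec]⟩
  obtain ⟨t, ht, ht'⟩ := exists_contDiffOn_angle (z := fun x => (f (proj e l x)).1)
    (isOpen_halfSpace e) (convex_halfSpace e) hne hG.fst
  exact ⟨t, _, ht, hG.snd, fun x => rfl, ht'⟩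

/-- A conformal equivalence lifts to a conformal map of the half-space, which intertwines the deck
transformation `dil e ((2 * π) • l)` with a power of `dil e ((2 * π) • m)`. -/
theorem exists_int_mul_of_conformallyEquivalent (hl : 0 < l.1 ∧ 0 < l.2)
    (h : PseudoConformal.ConformallyEquivalent ((𝓡 1).prod (𝓡 n)) (field e l) (field e m)) :
    ∃ k : ℤ, (k * m.1 = l.1 ∨ k * m.1 = l.2) ∧ (k * m.2 = l.1 ∨ k * m.2 = l.2) := by
  obtain ⟨f, c, hc, hc0, hfc⟩ := h
  have hf : ContMDiff ((𝓡 1).prod (𝓡 n)) ((𝓡 1).prod (𝓡 n)) ∞ f := f.contMDiff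
  obtain ⟨t, w, ht, hw, hw', ht'⟩ := exists_polar e hl hf
  have hopen := isOpen_halfSpace e
  let F : EuclideanSpace ℝ (Fin (n + 1)) → EuclideanSpace ℝ (Fin (n + 1)) :=
    fun x => dil e (t x • m) (w x)
  have hF : ContDiffOn ℝ ∞ F (halfSpace e) :=
    (contDiff_dil_smul e m).comp_contDiffOn (ht.prodMk hw)
  let C : EuclideanSpace ℝ (Fin (n + 1)) → ℝ := fun x =>
    Real.exp (2 * (t x * (m.1 + m.2))) *
      (c (proj e l x) * Real.exp (2 * (-time e l x * (l.1 + l.2))))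
  have hC : ContDiffOn ℝ ∞ C (halfSpace e) := by
    have h1 : ContDiff ℝ ∞ fun a : ℝ => Real.exp (2 * (a * (m.1 + m.2))) := by fun_prop
    have h2 : ContDiff ℝ ∞ fun a : ℝ => Real.exp (2 * (-a * (l.1 + l.2))) := by fun_prop
    refine (h1.comp_contDiffOn ht).mul (ContDiffOn.mul (fun x hx => ?_) (fun x hx => ?_))
    · have h3 := contMDiffAt_proj e hl (ne_zero_of_mem_halfSpace e hx)
      exact ((hc _).comp x h3).contDiffAt.contDiffWithinAt
    · exact (h2.contDiffAt.comp x
        (contDiffAt_time e hl (ne_zero_of_mem_halfSpace e hx))).contDiffWithinAt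
  have hC0 : ∀ x ∈ halfSpace e, C x ≠ 0 := fun x _ =>
    (mul_pos (Real.exp_pos _) (mul_pos (hc0 _) (Real.exp_pos _))).ne'
  have hconf : ∀ x ∈ halfSpace e, ∀ u v, metric e 1 (F x) (fderiv ℝ F x u) (fderiv ℝ F x v) =
      C x * metric e 1 x u v := by
    intro x hx u v
    have hx0 := ne_zero_of_mem_halfSpace e hx
    have hα : MDifferentiableAt 𝓘(ℝ, EuclideanSpace ℝ (Fin (n + 1))) ((𝓡 1).prod (𝓡 n))
        (fun y => f (proj e l y)) x :=
      ((hf _).comp x (contMDiffAt_proj e hl hx0)).mdifferentiableAt (by simp)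
    have heq : (fun y => emb (f (proj e l y))) =ᶠ[𝓝 x] fun y => ((Circle.exp (t y) : ℂ), w y) := by
      filter_upwards [hopen.mem_nhds hx] with y hy
      exact Prod.ext (congrArg (fun a : Circle => (a : ℂ)) (ht' y hy).symm) (hw' y)
    have htd := (ht.contDiffAt (hopen.mem_nhds hx)).differentiableAt (by simp)
    have hwd := (hw.contDiffAt (hopen.mem_nhds hx)).differentiableAt (by simp)
    have hD : ∀ u, fderiv ℝ F x u = dil e (t x • m) (frame e m (f (proj e l x))
        (mfderiv ((𝓡 1).prod (𝓡 n)) ((𝓡 1).prod (𝓡 n)) f (proj e l x)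
          (mfderiv 𝓘(ℝ, EuclideanSpace ℝ (Fin (n + 1))) ((𝓡 1).prod (𝓡 n)) (proj e l) x u))) := by
      intro u
      have h1 := frame_polar e hα htd hwd heq (l := m) u
      have h2 := mfderiv_comp_apply x (hf.mdifferentiable (by simp) (proj e l x))
        ((contMDiffAt_proj e hl hx0).mdifferentiableAt (by simp)) u
      have h3 := (congrArg (frame e m (f (proj e l x))) h2).symm.trans h1
      refine Eq.trans ?_ (congrArg (dil e (t x • m)) h3).symm
      rw [← dil_add, neg_smul, add_neg_cancel, dil_zero]
    have h4 : ∀ y (a b : TangentSpace ((𝓡 1).prod (𝓡 n)) y), field e m (f y)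
        (mfderiv ((𝓡 1).prod (𝓡 n)) ((𝓡 1).prod (𝓡 n)) f y a)
        (mfderiv ((𝓡 1).prod (𝓡 n)) ((𝓡 1).prod (𝓡 n)) f y b) = c y * field e l y a b := by
      intro y a b
      exact congrArg (fun L : TangentSpace ((𝓡 1).prod (𝓡 n)) y →L[ℝ]
        TangentSpace ((𝓡 1).prod (𝓡 n)) y →L[ℝ] ℝ => L a b) (hfc y)
    rw [hD, hD, metric_dil, ← hw' x]
    refine (congrArg (_ * ·) (h4 (proj e l x) _ _)).trans ?_
    rw [field_proj e hl hx0]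
    simp only [C, Prod.smul_fst, Prod.smul_snd, smul_eq_mul, mul_add, mul_assoc]
  have hx0 : vec e 0 ∈ halfSpace e := by
    change 0 < coord e 0 _
    simp [coord_vec]
  -- the deck transformation changes the lifted angle by a locally constant multiple of `2 * π`
  have hk : ∀ x ∈ halfSpace e, ∃ k : ℤ, t (dil e ((2 * Real.pi) • l) x) = t x + k * (2 * Real.pi) := by
    intro x hx
    refine Circle.exp_eq_exp.1 ?_
    rw [ht' _ (dil_mem_halfSpace e _ hx), ht' _ hx, proj_dil e hl (ne_zero_of_mem_halfSpace e hx)]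
  obtain ⟨k, hk0⟩ := hk _ hx0
  have htc : ContinuousAt (fun x => t (dil e ((2 * Real.pi) • l) x) - t x) (vec e 0) := by
    refine ContinuousAt.sub ?_ (ht.continuousOn.continuousAt (hopen.mem_nhds hx0))
    exact ContinuousAt.comp (ht.continuousOn.continuousAt
      (hopen.mem_nhds (dil_mem_halfSpace e _ hx0))) (dil e _).continuous.continuousAt
  have hnear : ∀ᶠ x in 𝓝 (vec e 0), t (dil e ((2 * Real.pi) • l) x) - t x ∈
      Ioo (((k : ℝ) - 1) * (2 * Real.pi)) (((k : ℝ) + 1) * (2 * Real.pi)) := by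
    refine htc.eventually_mem (Ioo_mem_nhds ?_ ?_) <;> rw [hk0] <;> linarith [Real.pi_pos]
  have hlm : ∀ᶠ x in 𝓝 (vec e 0), F (dil e ((2 * Real.pi) • l) x) =
      dil e ((k * (2 * Real.pi)) • m) (F x) := by
    filter_upwards [hnear, hopen.mem_nhds hx0] with x hx hxH
    obtain ⟨j, hj⟩ := hk x hxH
    rw [hj, add_sub_cancel_left] at hx
    have h1 : ((k : ℝ) - 1) < j := lt_of_mul_lt_mul_right hx.1 Real.two_pi_pos.le
    have h2 : (j : ℝ) < k + 1 := lt_of_mul_lt_mul_right hx.2 Real.two_pi_pos.le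
    have hjk : j = k := by
      have h1' : k - 1 < j := by exact_mod_cast h1
      have h2' : j < k + 1 := by exact_mod_cast h2
      omega
    have hwx : w (dil e ((2 * Real.pi) • l) x) = w x := by
      rw [← hw', ← hw', proj_dil e hl (ne_zero_of_mem_halfSpace e hxH)]
    simp only [F]
    rw [hwx, hj, hjk, ← dil_add, add_smul, add_comm (t x • m)]
  have hfin := weights_of_intertwining e hF hC hC0 hconf hlm
  have hcancel : ∀ a b : ℝ, k * (2 * Real.pi) * a = 2 * Real.pi * b → k * a = b := fun a b hab =>
    mul_left_cancel₀ Real.two_pi_pos.ne' (by linarith)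
  exact ⟨k, hfin.1.imp (hcancel _ _) (hcancel _ _), hfin.2.imp (hcancel _ _) (hcancel _ _)⟩

/-- The parameter set. On it, no component of a parameter is an integer multiple of a component of
another one, except for equal components in the same place. -/
def parameters : Set (ℝ × ℝ) := Ioo 4 5 ×ˢ Ioo 5 6

theorem pos_of_mem_parameters (hl : l ∈ parameters) : 0 < l.1 ∧ 0 < l.2 :=
  ⟨by linarith [hl.1.1], by linarith [hl.2.1]⟩

theorem not_conformallyEquivalent (hl : l ∈ parameters) (hm : m ∈ parameters) (hne : l ≠ m) :
    ¬ PseudoConformal.ConformallyEquivalent ((𝓡 1).prod (𝓡 n)) (field e l) (field e m) := by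
  intro h
  obtain ⟨k, h1, h2⟩ := exists_int_mul_of_conformallyEquivalent e (pos_of_mem_parameters hl) h
  obtain ⟨⟨hl1, hl2⟩, hl3, hl4⟩ := hl
  obtain ⟨⟨hm1, hm2⟩, hm3, hm4⟩ := hm
  have hk : k = 1 := by
    have hk0 : 0 < k := by
      by_contra! hk
      have : (k : ℝ) ≤ 0 := by exact_mod_cast hk
      rcases h1 with h | h <;> nlinarith
    have hk2 : k < 2 := by
      by_contra! hk
      have : (2 : ℝ) ≤ k := by exact_mod_cast hk
      rcases h1 with h | h <;> nlinarith
    omega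
  subst hk
  simp only [Int.cast_one, one_mul] at h1 h2
  refine hne (Prod.ext ?_ ?_)
  · rcases h1 with h | h <;> linarith
  · rcases h2 with h | h <;> linarith

end

end PlaneWave

end

theorem theorem3 (p q n : ℕ) (hp : 2 ≤ p) (hpq : p ≤ q) (hn : n + 1 = p + q) :
    ∃ (Λ : Set (ℝ × ℝ))
      (g : ℝ × ℝ → PseudoConformal.BilinField ((𝓡 1).prod (𝓡 n))
        (Circle × Metric.sphere (0 : EuclideanSpace ℝ (Fin (n + 1))) 1)),
      IsOpen Λ ∧ Λ.Nonempty ∧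
      PseudoConformal.IsAnalyticFamilyOn ((𝓡 1).prod (𝓡 n)) Λ g ∧
      (∀ l ∈ Λ,
        PseudoConformal.IsPseudoRiemannianMetric ((𝓡 1).prod (𝓡 n)) ω p q (g l) ∧
        ¬ PseudoConformal.IsConformallyFlat ((𝓡 1).prod (𝓡 n)) p q (g l) ∧
        PseudoConformal.IsEssential ((𝓡 1).prod (𝓡 n)) (g l) ∧
        PseudoConformal.IsStronglyEssential ((𝓡 1).prod (𝓡 n)) (g l)) ∧
      (∀ l ∈ Λ, ∀ m ∈ Λ, l ≠ m →
        ¬ PseudoConformal.ConformallyEquivalent ((𝓡 1).prod (𝓡 n)) (g l) (g m)) := by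
  obtain ⟨r, rfl⟩ := Nat.exists_eq_add_of_le' hp
  obtain ⟨s, rfl⟩ := Nat.exists_eq_add_of_le' (hp.trans hpq)
  -- four distinguished coordinates, `r = p - 2` negative and `s = q - 2` positive ones
  have e : Fin 4 ⊕ (Fin r ⊕ Fin s) ≃ Fin (n + 1) := Fintype.equivOfCardEq (by simp; omega)
  refine ⟨PlaneWave.parameters, PlaneWave.field e, isOpen_Ioo.prod isOpen_Ioo, ⟨(9 / 2, 11 / 2), by
    constructor <;> constructor <;> norm_num⟩, PlaneWave.isAnalyticFamilyOn_field e _, fun l hl => ?_,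
    fun l hl m hm hne => PlaneWave.not_conformallyEquivalent e hl hm hne⟩
  have hl' := PlaneWave.pos_of_mem_parameters hl
  exact ⟨PlaneWave.isPseudoRiemannianMetric_field e hl', PlaneWave.not_isConformallyFlat_field e hl',
    PlaneWave.isEssential_field e hl', PlaneWave.isStronglyEssential_field e hl'⟩
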